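/- Let $n\ge 3$ and let $\rho\in\mathbb R$ satisfy $\rho<\frac1{2(n-1)}$ or $\rho\ge\frac1{n-1}$. Let $(M^n,g)$ be a complete, noncompact, rotationally symmetric gradient steady $\rho$-Einstein soliton with positive sectional curvature; that is, $M=\mathbb R^n$ with origin $O$, $g$ is a smooth Riemannian metric on $M$ which on $M\setminus\{O\}$ has the form $g=dr\otimes dr+\omega(r)^2\,g_{\mathbb S^{n-1}}$, where $r=|x|$, $\omega:(0,\infty)\to(0,\infty)$ is smooth and $g_{\mathbb S^{n-1}}$ is the round metric of the unit sphere, all sectional curvatures of $g$ are positive, and there is a smooth function $f:M\to\mathbb R$ with $$\mathrm{Ric}+\nabla^2 f=\rho R\,g .$$ Assume that the scalar curvature is normalized by $R(O)=1$. For functions $u,v$ with $v>0$ write $u=\mathcal O(v)$ as $r\to\infty$ if there are positive constants $A,B,r_0$ with $A\,v(r)<u(r)<B\,v(r)$ for all $r>r_0$. Then $f$ depends only on $r$ and, as $r\to\infty$, $$\omega(r)=\mathcal O\Big(r^{\frac{1-(n-1)\rho}{2-3(n-1)\rho}}\Big),\qquad |f(r)|=\mathcal O\Big(r^{\frac{2-4(n-1)\rho}{2-3(n-1)\rho}}\Big),\qquad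 \mathrm{Vol}_g(B_r(O))=\mathcal O\Big(r^{(n-1)\frac{1-(n-1)\rho}{2-3(n-1)\rho}+1}\Big),$$ where $B_r(O)$ is the geodesic ball of radius $r$ centered at $O$. Moreover, if $\rho=\frac1{n-1}$, then the soliton has linear volume growth, $\mathrm{Vol}_g(B_r(O))=\mathcal O(r)$, and is asymptotically cylindrical: there is $c>0$ such that, as $r\to\infty$, $\omega(r)\to c$ and all derivatives of $\omega$ of order at least one tend to $0$. -/

import Mathlib

open Filter Topology MeasureTheory
open scoped ContDiff

/-! Riemannian geometry of a smooth metric on `ℝⁿ`, in the global Cartesian coordinates. -/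

noncomputable section

/-- The manifold `ℝⁿ`. -/
abbrev RSpace (n : ℕ) : Type := EuclideanSpace ℝ (Fin n)

/-- The `k`-th partial derivative of `h` at `x`. -/
def pderivAt {n : ℕ} (k : Fin n) (h : RSpace n → ℝ) (x : RSpace n) : ℝ :=
  fderiv ℝ h x (EuclideanSpace.single k 1)

/-- A smooth Riemannian metric on `ℝⁿ`, given by its components `g_ij`. -/
structure RMetric (n : ℕ) where
  coeff : RSpace n → Matrix (Fin n) (Fin n) ℝ
  smooth : ∀ i j, ContDiff ℝ ∞ (fun x => coeff x i j)
  posDef : ∀ x, (coeff x).PosDef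

namespace RMetric

variable {n : ℕ}

/-- `g_x(u, v)`. -/
def ip (g : RMetric n) (x u v : RSpace n) : ℝ :=
  ∑ i, ∑ j, g.coeff x i j * u i * v j

/-- Christoffel symbol `Γ^k_{ij}` of the Levi-Civita connection. -/
def christoffel (g : RMetric n) (k i j : Fin n) (x : RSpace n) : ℝ :=
  (1 / 2) * ∑ l, (g.coeff x)⁻¹ k l *
    (pderivAt i (fun y => g.coeff y j l) x + pderivAt j (fun y => g.coeff y i l) x
      - pderivAt l (fun y => g.coeff y i j) x)

/-- Components of the curvature tensor: `R(∂_i, ∂_j) ∂_k = ∑ l, (g.riem i j k l) ∂_l`, with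
`R(X, Y) Z = ∇_X ∇_Y Z - ∇_Y ∇_X Z - ∇_[X,Y] Z`. -/
def riem (g : RMetric n) (i j k l : Fin n) (x : RSpace n) : ℝ :=
  pderivAt i (g.christoffel l j k) x - pderivAt j (g.christoffel l i k) x
    + ∑ m, (g.christoffel l i m x * g.christoffel m j k x
        - g.christoffel l j m x * g.christoffel m i k x)

/-- Ricci tensor `Ric_{jk}`, the trace of `X ↦ R(X, ∂_j) ∂_k`. -/
def ricci (g : RMetric n) (j k : Fin n) (x : RSpace n) : ℝ :=
  ∑ i, g.riem i j k i x

/-- Scalar curvature. -/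
def scalar (g : RMetric n) (x : RSpace n) : ℝ :=
  ∑ j, ∑ k, (g.coeff x)⁻¹ j k * g.ricci j k x

/-- Sectional curvature at `x` of the plane spanned by two linearly independent vectors `u`, `v`:
`g(R(u, v) v, u) / (g(u, u) g(v, v) - g(u, v)²)`. -/
def sectional (g : RMetric n) (x u v : RSpace n) : ℝ :=
  (∑ i, ∑ j, ∑ k, ∑ l, ∑ m, u i * v j * v k * g.riem i j k l x * g.coeff x l m * u m) /
    (g.ip x u u * g.ip x v v - g.ip x u v ^ 2)

/-- All sectional curvatures are positive. -/
def HasPositiveSectionalCurvature (g : RMetric n) : Prop :=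
  ∀ x u v : RSpace n, LinearIndependent ℝ ![u, v] → 0 < g.sectional x u v

/-- Components `∇²_{ij} f` of the Hessian of `f`. -/
def hessian (g : RMetric n) (f : RSpace n → ℝ) (i j : Fin n) (x : RSpace n) : ℝ :=
  pderivAt i (pderivAt j f) x - ∑ k, g.christoffel k i j x * pderivAt k f x

/-- `f` is smooth and `Ric + ∇² f = ρ R g + lam g`, i.e. `g` is a gradient `ρ`-Einstein soliton
with potential `f`; it is steady for `lam = 0`. -/
def IsGradientEinsteinSoliton (g : RMetric n) (f : RSpace n → ℝ) (ρ lam : ℝ) : Prop :=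
  ContDiff ℝ ∞ f ∧ ∀ (i j : Fin n) (x : RSpace n),
    g.ricci i j x + g.hessian f i j x = ρ * g.scalar x * g.coeff x i j + lam * g.coeff x i j

/-- Rotational symmetry about the origin `O`, with warping factor `w`: with `r = |x|`,
`g = dr ⊗ dr + w(r)² g_can` on `ℝⁿ ∖ {O}`, where `w` is a positive smooth function on `(0, ∞)`
and `g_can` is the round metric of the unit sphere, pulled back by `x ↦ x / |x|`.
As `r` ranges over the whole of `(0, ∞)`, such a metric is complete. -/
def IsRotationallySymmetric (g : RMetric n) (w : ℝ → ℝ) : Prop :=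
  ContDiffOn ℝ ∞ w (Set.Ioi 0) ∧ (∀ r, 0 < r → 0 < w r) ∧
    ∀ x u v : RSpace n, x ≠ 0 →
      g.ip x u v =
        fderiv ℝ (fun y : RSpace n => ‖y‖) x u * fderiv ℝ (fun y : RSpace n => ‖y‖) x v
        + w ‖x‖ ^ 2 * inner ℝ (fderiv ℝ (fun y : RSpace n => ‖y‖⁻¹ • y) x u)
            (fderiv ℝ (fun y : RSpace n => ‖y‖⁻¹ • y) x v)

/-- Length of the curve `γ` restricted to `[0, 1]`. -/
def curveLength (g : RMetric n) (γ : ℝ → RSpace n) : ℝ :=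
  ∫ t in (0 : ℝ)..1, Real.sqrt (g.ip (γ t) (deriv γ t) (deriv γ t))

/-- Riemannian distance: infimum of the lengths of the `C¹` curves from `x` to `y`. -/
def rdist (g : RMetric n) (x y : RSpace n) : ℝ :=
  sInf {L | ∃ γ : ℝ → RSpace n, ContDiff ℝ 1 γ ∧ γ 0 = x ∧ γ 1 = y ∧ L = g.curveLength γ}

/-- The geodesic ball `B_r(x)`. -/
def rball (g : RMetric n) (x : RSpace n) (r : ℝ) : Set (RSpace n) :=
  {y | g.rdist x y < r}

/-- The Riemannian volume measure `√(det g) dx`. -/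
def vol (g : RMetric n) : Measure (RSpace n) :=
  volume.withDensity (fun x => ENNReal.ofReal (Real.sqrt (g.coeff x).det))

end RMetric

/-- The relation `u = 𝒪(v)` as `r → +∞` in the two-sided sense:
`A v(r) < u(r) < B v(r)` for all `r > r₀`, with constants `A, B, r₀ > 0`. -/
def TwoSidedO (u v : ℝ → ℝ) : Prop :=
  ∃ A B r₀ : ℝ, 0 < A ∧ 0 < B ∧ 0 < r₀ ∧ ∀ r, r₀ < r → A * v r < u r ∧ u r < B * v r

/-- The end of `dr ⊗ dr + w(r)² g_can` is asymptotic to the round cylinder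
`dr ⊗ dr + c² g_can` of some radius `c > 0`, in the `C^∞` sense. -/
def IsAsymptoticallyCylindrical (w : ℝ → ℝ) : Prop :=
  ∃ c : ℝ, 0 < c ∧ Tendsto w atTop (𝓝 c) ∧
    ∀ k : ℕ, 1 ≤ k → Tendsto (iteratedDeriv k w) atTop (𝓝 0)

end

/-! Put `m = (n-1)ρ` and `c = n-2`; the hypothesis on `ρ` says `m < 1/2` or `m ≥ 1`. Computing the
curvature of `dr² + w²g_can` in Cartesian coordinates (`riem_eq`, `ricci_eq`) turns positive
curvature into `w'' < 0` and `w'² < 1`; concavity and positivity of `w` on a half-line then force `0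
< w' < 1`.

The potential is radial. The mixed part of the soliton equation makes the angular derivative of `f`
proportional to `w(r)`, so on a circle `f` is a radial term plus `w(r) D(s)`. The spherical part
then expresses an `r`-independent quantity as `-w'(r)² D(s)`, and `w'` is not constant, so `D = 0`
(`apply_circ_eq`). What remains is the system `SolitonODE`.

For `m ≠ 1`, eliminate `φ` and use `K = -w w''` and `X = w'²`. Up to the positive factor `1/(w w')`,
`K' = -K² - bK + eKX + cX(1-X)` and `X' = -2KX`, where `b = (1-m)c/(1-2m) > 0`. Hence `K` is
bounded. To first order `K ≈ cX/b`, which suggests that `w' w^γ` with `γ = c/b` is nearly constant.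
Indeed the derivative of `log w' + γ log w - K/b` is quadratic in `(K, X)`, and a bounded Lyapunov
function has a derivative dominating it (`exists_abs_log_le`). Thus `(w^(γ+1))'` lies between
positive constants, giving `w ~ r^(1/(γ+1))`. In `w w' φ'` the two terms have the same sign and are
bounded, so `φ'`, and after integration `φ`, follows.

For `m = 1` one has `b = 0`, but the spherical equation collapses to `w'' = -w' φ'`. A barrier keeps
`w φ'` away from zero, so `w` is bounded and `w'` decays exponentially. Every higher derivative of
`w` is `w'` times a function of polynomial growth, and `φ''` has a positive limit.

Finally, geodesic balls about `O` are Euclidean balls with volume density `(w/r)^(n-1)`, so volume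
growth is the integral of `w^(n-1)`. -/

/-! ### Index sums and partial derivatives of radial functions. -/

/-- Kronecker delta. -/
def kd {n : ℕ} (i j : Fin n) : ℝ := if i = j then 1 else 0

lemma kd_comm {n : ℕ} (i j : Fin n) : kd i j = kd j i := by
  simp [kd, eq_comm]

lemma kd_self {n : ℕ} (i : Fin n) : kd i i = 1 := by simp [kd]

lemma kd_ne {n : ℕ} {i j : Fin n} (h : i ≠ j) : kd i j = 0 := by simp [kd, h]

lemma sum_kd_mul {n : ℕ} (i : Fin n) (h : Fin n → ℝ) : ∑ l, kd i l * h l = h i := by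
  simp [kd]

lemma sum_coord_mul_self {n : ℕ} (x : RSpace n) : ∑ l, x l * x l = ‖x‖ ^ 2 := by
  rw [EuclideanSpace.norm_sq_eq]
  exact Finset.sum_congr rfl fun i _ => by rw [Real.norm_eq_abs, sq_abs, sq]

/-- Tensors built from `δ` and `x` contract through this one pattern; it serves the inverse metric,
the Christoffel symbols, the curvature and the scalar curvature. -/
lemma sum_three_mul_three {n : ℕ} (x : RSpace n) (i j k l : Fin n) (A B C D E F : ℝ) :
    ∑ m, (A * kd l m + B * kd i m + C * x m) * (D * kd k m + E * kd j m + F * x m)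
      = A * D * kd k l + A * E * kd j l + A * F * x l + B * D * kd k i + B * E * kd j i
        + B * F * x i + C * D * x k + C * E * x j + C * F * ‖x‖ ^ 2 := by
  have h : ∀ m, (A * kd l m + B * kd i m + C * x m) * (D * kd k m + E * kd j m + F * x m)
      = A * D * (kd l m * kd k m) + A * E * (kd l m * kd j m) + A * F * (kd l m * x m)
        + B * D * (kd i m * kd k m) + B * E * (kd i m * kd j m) + B * F * (kd i m * x m)
        + C * D * (kd k m * x m) + C * E * (kd j m * x m) + C * F * (x m * x m) :=
    fun m => by ring
  simp only [h, Finset.sum_add_distrib, ← Finset.mul_sum, sum_kd_mul, sum_coord_mul_self]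

/-- `h` is differentiable at `x` with `k`-th partial derivative `d`. -/
def HasPderivAt {n : ℕ} (k : Fin n) (h : RSpace n → ℝ) (d : ℝ) (x : RSpace n) : Prop :=
  DifferentiableAt ℝ h x ∧ pderivAt k h x = d

namespace HasPderivAt

variable {n : ℕ} {k : Fin n} {x : RSpace n} {h₁ h₂ : RSpace n → ℝ} {d₁ d₂ : ℝ}

lemma add (H₁ : HasPderivAt k h₁ d₁ x) (H₂ : HasPderivAt k h₂ d₂ x) :
    HasPderivAt k (fun y => h₁ y + h₂ y) (d₁ + d₂) x := by
  refine ⟨H₁.1.add H₂.1, ?_⟩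
  rw [← H₁.2, ← H₂.2, pderivAt, fderiv_fun_add H₁.1 H₂.1]
  rfl

lemma mul (H₁ : HasPderivAt k h₁ d₁ x) (H₂ : HasPderivAt k h₂ d₂ x) :
    HasPderivAt k (fun y => h₁ y * h₂ y) (d₁ * h₂ x + h₁ x * d₂) x := by
  refine ⟨H₁.1.mul H₂.1, ?_⟩
  rw [← H₁.2, ← H₂.2, pderivAt, fderiv_fun_mul H₁.1 H₂.1]
  simp [pderivAt]
  ring

lemma const (k : Fin n) (x : RSpace n) (a : ℝ) : HasPderivAt k (fun _ => a) 0 x :=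
  ⟨differentiableAt_const a, by simp [pderivAt]⟩

lemma coord (k i : Fin n) (x : RSpace n) : HasPderivAt k (fun y => y i) (kd k i) x := by
  have h : HasFDerivAt (fun y : RSpace n => y i) (EuclideanSpace.proj (𝕜 := ℝ) i) x :=
    (EuclideanSpace.proj (𝕜 := ℝ) i : RSpace n →L[ℝ] ℝ).hasFDerivAt
  refine ⟨h.differentiableAt, ?_⟩
  rw [pderivAt, h.fderiv]
  simp [kd, eq_comm]

lemma congr (H : HasPderivAt k h₁ d₁ x) (he : h₂ =ᶠ[𝓝 x] h₁) (hd : d₁ = d₂) :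
    HasPderivAt k h₂ d₂ x := by
  refine ⟨H.1.congr_of_eventuallyEq he, ?_⟩
  rw [pderivAt, he.fderiv_eq, ← hd]
  exact H.2

end HasPderivAt

lemma hasFDerivAt_norm {n : ℕ} {x : RSpace n} (hx : x ≠ 0) :
    HasFDerivAt (fun y : RSpace n => ‖y‖) (‖x‖⁻¹ • innerSL ℝ x) x := by
  have h := (hasStrictFDerivAt_norm_sq x).hasFDerivAt.sqrt
    (by simpa using hx : ‖x‖ ^ 2 ≠ 0)
  have e : (fun y : RSpace n => √(‖y‖ ^ 2)) = fun y => ‖y‖ := by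
    funext y
    exact Real.sqrt_sq (norm_nonneg y)
  rw [e] at h
  refine h.congr_fderiv ?_
  rw [Real.sqrt_sq (norm_nonneg x)]
  ext v
  simp
  ring

lemma HasPderivAt.radial {n : ℕ} {x : RSpace n} (hx : x ≠ 0) (k : Fin n) {h : ℝ → ℝ} {h' : ℝ}
    (hh : HasDerivAt h h' ‖x‖) :
    HasPderivAt k (fun y => h ‖y‖) (h' / ‖x‖ * x k) x := by
  have := hh.comp_hasFDerivAt x (hasFDerivAt_norm hx)
  refine ⟨this.differentiableAt, ?_⟩
  rw [pderivAt]
  have e : fderiv ℝ (fun y : RSpace n => h ‖y‖) x = _ := this.fderiv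
  rw [e]
  simp [EuclideanSpace.inner_single_right]
  ring

/-! ### Metric, Christoffel symbols and curvature tensor in Cartesian coordinates. -/

namespace RMetric

variable {n : ℕ}

lemma ip_single (g : RMetric n) (x : RSpace n) (i j : Fin n) :
    g.ip x (EuclideanSpace.single i 1) (EuclideanSpace.single j 1) = g.coeff x i j := by
  simp [ip]

/-- The normal form of a rotationally symmetric metric, as a function of two vectors. -/
lemma IsRotationallySymmetric.ip_eq {g : RMetric n} {w : ℝ → ℝ} (hs : g.IsRotationallySymmetric w)
    {x : RSpace n} (hx : x ≠ 0) (u v : RSpace n) :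
    g.ip x u v = w ‖x‖ ^ 2 / ‖x‖ ^ 2 * inner ℝ u v
      + (1 - w ‖x‖ ^ 2 / ‖x‖ ^ 2) / ‖x‖ ^ 2 * (inner ℝ x u * inner ℝ x v) := by
  have hn : ‖x‖ ≠ 0 := norm_ne_zero_iff.2 hx
  have h1 := hasFDerivAt_norm hx
  have h2 : HasFDerivAt (fun y : RSpace n => ‖y‖⁻¹ • y) _ x :=
    ((hasDerivAt_inv hn).comp_hasFDerivAt x h1).smul (hasFDerivAt_id x)
  have key : ∀ u, fderiv ℝ (fun y : RSpace n => ‖y‖⁻¹ • y) x u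
      = ‖x‖⁻¹ • u - (‖x‖⁻¹ ^ 3 * inner ℝ x u) • x := by
    intro u
    rw [h2.fderiv, sub_eq_add_neg, ← neg_smul]
    simp only [add_apply, smul_apply, ContinuousLinearMap.smulRight_apply, Function.comp_apply,
      ContinuousLinearMap.id_apply, innerSL_apply_apply, smul_eq_mul]
    congr 2
    field_simp
  rw [hs.2.2 x u v hx, h1.fderiv, key, key]
  simp only [inner_sub_left, inner_sub_right, inner_smul_left, inner_smul_right,
    real_inner_self_eq_norm_sq, smul_apply, innerSL_apply_apply, smul_eq_mul,
    RCLike.conj_to_real, real_inner_comm x u]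
  field_simp
  ring

lemma IsRotationallySymmetric.coeff_eq {g : RMetric n} {w : ℝ → ℝ}
    (hs : g.IsRotationallySymmetric w) {x : RSpace n} (hx : x ≠ 0) (i j : Fin n) :
    g.coeff x i j = w ‖x‖ ^ 2 / ‖x‖ ^ 2 * kd i j
      + (1 - w ‖x‖ ^ 2 / ‖x‖ ^ 2) / ‖x‖ ^ 2 * (x i * x j) := by
  rw [← ip_single, hs.ip_eq hx]
  simp [EuclideanSpace.inner_single_right, kd, eq_comm]

/-- The metric has eigenvalue `1` in the radial direction and `w²/r²` on its orthogonal complement,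
so inversion replaces `w²/r²` by its reciprocal in the same formula. -/
lemma IsRotationallySymmetric.coeff_inv {g : RMetric n} {w : ℝ → ℝ}
    (hs : g.IsRotationallySymmetric w) {x : RSpace n} (hx : x ≠ 0) (i j : Fin n) :
    (g.coeff x)⁻¹ i j = ‖x‖ ^ 2 / w ‖x‖ ^ 2 * kd i j
      + (1 - ‖x‖ ^ 2 / w ‖x‖ ^ 2) / ‖x‖ ^ 2 * (x i * x j) := by
  have hn : 0 < ‖x‖ := norm_pos_iff.2 hx
  have hw := hs.2.1 _ hn
  have : (g.coeff x)⁻¹ = Matrix.of fun i j => ‖x‖ ^ 2 / w ‖x‖ ^ 2 * kd i j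
      + (1 - ‖x‖ ^ 2 / w ‖x‖ ^ 2) / ‖x‖ ^ 2 * (x i * x j) := by
    apply Matrix.inv_eq_right_inv
    ext i j
    rw [Matrix.mul_apply]
    have h : ∀ m, g.coeff x i m * (Matrix.of fun i j => ‖x‖ ^ 2 / w ‖x‖ ^ 2 * kd i j
        + (1 - ‖x‖ ^ 2 / w ‖x‖ ^ 2) / ‖x‖ ^ 2 * (x i * x j)) m j
        = (w ‖x‖ ^ 2 / ‖x‖ ^ 2 * kd i m + 0 * kd i m
            + ((1 - w ‖x‖ ^ 2 / ‖x‖ ^ 2) / ‖x‖ ^ 2 * x i) * x m)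
          * (‖x‖ ^ 2 / w ‖x‖ ^ 2 * kd j m + 0 * kd j m
            + ((1 - ‖x‖ ^ 2 / w ‖x‖ ^ 2) / ‖x‖ ^ 2 * x j) * x m) := by
      intro m
      rw [hs.coeff_eq hx, Matrix.of_apply, kd_comm m j]
      ring
    simp only [h, sum_three_mul_three]
    rw [Matrix.one_apply, kd_comm j i]
    change _ = kd i j
    field_simp
    ring
  rw [this, Matrix.of_apply]

end RMetric

lemma sum_inv_mul {n : ℕ} (x : RSpace n) (i j k : Fin n) (a b A B C : ℝ) :
    ∑ l, (a * kd k l + b * (x k * x l)) * (A * kd j l + B * kd i l + C * x l)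
      = a * (A * kd j k + B * kd i k + C * x k)
        + b * x k * (A * x j + B * x i + C * ‖x‖ ^ 2) := by
  have h : ∀ l, (a * kd k l + b * (x k * x l)) * (A * kd j l + B * kd i l + C * x l)
      = (a * kd k l + 0 * kd k l + b * x k * x l) * (B * kd i l + A * kd j l + C * x l) :=
    fun l => by ring
  simp only [h, sum_three_mul_three, kd_comm i k, kd_comm j k]
  ring

/-- Coefficient of `x_i δ_jk + x_j δ_ik` in the Christoffel symbols. -/
noncomputable def chrisP (w : ℝ → ℝ) (r : ℝ) : ℝ := deriv w r / (w r * r) - 1 / r ^ 2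

/-- Coefficient of `δ_ij x_k` in the Christoffel symbols. -/
noncomputable def chrisQ (w : ℝ → ℝ) (r : ℝ) : ℝ := 1 / r ^ 2 - w r * deriv w r / r ^ 3

/-- Coefficient of `x_i x_j x_k` in the Christoffel symbols. -/
noncomputable def chrisT (w : ℝ → ℝ) (r : ℝ) : ℝ := -(2 * chrisP w r + chrisQ w r) / r ^ 2

namespace RMetric

variable {n : ℕ}

namespace IsRotationallySymmetric

variable {g : RMetric n} {w : ℝ → ℝ} (hs : g.IsRotationallySymmetric w)

include hs

lemma contDiffOn_deriv : ContDiffOn ℝ ∞ (deriv w) (Set.Ioi 0) :=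
  hs.1.deriv_of_isOpen isOpen_Ioi (by simp)

lemma hasDerivAt {r : ℝ} (hr : 0 < r) : HasDerivAt w (deriv w r) r :=
  ((hs.1.differentiableOn (by simp)).differentiableAt (Ioi_mem_nhds hr)).hasDerivAt

lemma hasDerivAt_deriv {r : ℝ} (hr : 0 < r) : HasDerivAt (deriv w) (deriv (deriv w) r) r :=
  ((hs.contDiffOn_deriv.differentiableOn (by simp)).differentiableAt
    (Ioi_mem_nhds hr)).hasDerivAt

lemma coeff_eventuallyEq {x : RSpace n} (hx : x ≠ 0) (i j : Fin n) :
    (fun y => g.coeff y i j) =ᶠ[𝓝 x] fun y => w ‖y‖ ^ 2 / ‖y‖ ^ 2 * kd i j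
      + (1 - w ‖y‖ ^ 2 / ‖y‖ ^ 2) / ‖y‖ ^ 2 * (y i * y j) := by
  filter_upwards [isOpen_ne.mem_nhds hx] with y hy using hs.coeff_eq hy i j

lemma pderivAt_coeff {x : RSpace n} (hx : x ≠ 0) (k i j : Fin n) :
    pderivAt k (fun y => g.coeff y i j) x
      = (2 * w ‖x‖ * deriv w ‖x‖ / ‖x‖ ^ 3 - 2 * w ‖x‖ ^ 2 / ‖x‖ ^ 4) * x k * kd i j
        + (-(2 * w ‖x‖ * deriv w ‖x‖ / ‖x‖ ^ 5 - 2 * w ‖x‖ ^ 2 / ‖x‖ ^ 6)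
          - 2 * (1 - w ‖x‖ ^ 2 / ‖x‖ ^ 2) / ‖x‖ ^ 4) * (x i * x j * x k)
        + (1 - w ‖x‖ ^ 2 / ‖x‖ ^ 2) / ‖x‖ ^ 2 * (kd k i * x j + kd k j * x i) := by
  have hn : 0 < ‖x‖ := norm_pos_iff.2 hx
  have ha : HasDerivAt (fun r => w r ^ 2 / r ^ 2) _ ‖x‖ :=
    ((hs.hasDerivAt hn).pow 2).fun_div (hasDerivAt_pow 2 ‖x‖) (by positivity)
  have hb : HasDerivAt (fun r => (1 - w r ^ 2 / r ^ 2) / r ^ 2) _ ‖x‖ :=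
    (ha.const_sub 1).fun_div (hasDerivAt_pow 2 ‖x‖) (by positivity)
  refine ((((HasPderivAt.radial hx k ha).mul (HasPderivAt.const k x (kd i j))).add
    ((HasPderivAt.radial hx k hb).mul
      ((HasPderivAt.coord k i x).mul (HasPderivAt.coord k j x)))).congr
    (hs.coeff_eventuallyEq hx i j) ?_).2
  simp only [Pi.pow_apply]
  field_simp
  ring

lemma christoffel_eq {x : RSpace n} (hx : x ≠ 0) (k i j : Fin n) :
    g.christoffel k i j x = chrisP w ‖x‖ * (x i * kd j k + x j * kd i k)
      + chrisQ w ‖x‖ * (kd i j * x k) + chrisT w ‖x‖ * (x i * x j * x k) := by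
  have hn : 0 < ‖x‖ := norm_pos_iff.2 hx
  have hw := hs.2.1 _ hn
  have h : ∀ l, (g.coeff x)⁻¹ k l *
      (pderivAt i (fun y => g.coeff y j l) x + pderivAt j (fun y => g.coeff y i l) x
        - pderivAt l (fun y => g.coeff y i j) x)
      = (‖x‖ ^ 2 / w ‖x‖ ^ 2 * kd k l
        + (1 - ‖x‖ ^ 2 / w ‖x‖ ^ 2) / ‖x‖ ^ 2 * (x k * x l)) *
        ((2 * w ‖x‖ * deriv w ‖x‖ / ‖x‖ ^ 3 - 2 * w ‖x‖ ^ 2 / ‖x‖ ^ 4) * x i * kd j l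
        + (2 * w ‖x‖ * deriv w ‖x‖ / ‖x‖ ^ 3 - 2 * w ‖x‖ ^ 2 / ‖x‖ ^ 4) * x j * kd i l
        + ((2 * ((1 - w ‖x‖ ^ 2 / ‖x‖ ^ 2) / ‖x‖ ^ 2)
            - (2 * w ‖x‖ * deriv w ‖x‖ / ‖x‖ ^ 3 - 2 * w ‖x‖ ^ 2 / ‖x‖ ^ 4)) * kd i j
          + (-(2 * w ‖x‖ * deriv w ‖x‖ / ‖x‖ ^ 5 - 2 * w ‖x‖ ^ 2 / ‖x‖ ^ 6)
          - 2 * (1 - w ‖x‖ ^ 2 / ‖x‖ ^ 2) / ‖x‖ ^ 4) * (x i * x j)) * x l) := by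
    intro l
    rw [hs.coeff_inv hx, hs.pderivAt_coeff hx, hs.pderivAt_coeff hx, hs.pderivAt_coeff hx,
      kd_comm j i, kd_comm l i, kd_comm l j]
    ring
  rw [christoffel]
  simp only [h, sum_inv_mul, chrisP, chrisQ, chrisT]
  field_simp
  ring

/-- The curvature tensor of a warped product `dr ⊗ dr + w(r)² g_can`. -/
lemma riem_eq {x : RSpace n} (hx : x ≠ 0) (i j k l : Fin n) :
    g.riem i j k l x = (1 - deriv w ‖x‖ ^ 2) / ‖x‖ ^ 2 * (kd i l * kd j k - kd j l * kd i k)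
      + ((1 - deriv w ‖x‖ ^ 2) / ‖x‖ ^ 2 + deriv (deriv w) ‖x‖ / w ‖x‖) / ‖x‖ ^ 2
        * (x k * (x i * kd j l - x j * kd i l))
      + (-(w ‖x‖ * deriv (deriv w) ‖x‖) / ‖x‖ ^ 2 - (1 - deriv w ‖x‖ ^ 2) / ‖x‖ ^ 2) / ‖x‖ ^ 2
        * (x l * (x i * kd j k - x j * kd i k)) := by
  have hn : 0 < ‖x‖ := norm_pos_iff.2 hx
  have hw := hs.2.1 _ hn
  have h0 := hs.hasDerivAt hn
  have h1 := hs.hasDerivAt_deriv hn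
  have hP : HasDerivAt (chrisP w) _ ‖x‖ :=
    (h1.fun_div (h0.fun_mul (hasDerivAt_id' ‖x‖)) (by positivity)).fun_sub
      ((hasDerivAt_const ‖x‖ (1 : ℝ)).fun_div (hasDerivAt_pow 2 ‖x‖) (by positivity))
  have hQ : HasDerivAt (chrisQ w) _ ‖x‖ :=
    ((hasDerivAt_const ‖x‖ (1 : ℝ)).fun_div (hasDerivAt_pow 2 ‖x‖) (by positivity)).fun_sub
      ((h0.fun_mul h1).fun_div (hasDerivAt_pow 3 ‖x‖) (by positivity))
  have hT : HasDerivAt (chrisT w) _ ‖x‖ :=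
    ((hP.const_mul 2).fun_add hQ).fun_neg.fun_div (hasDerivAt_pow 2 ‖x‖) (by positivity)
  -- The derivative is produced by the product rule itself; the closed form near `x` is what gets
  -- differentiated.
  have hd : ∀ i j k l : Fin n, pderivAt i (g.christoffel l j k) x = _ := fun i j k l =>
    (((((HasPderivAt.radial hx i hP).mul
      (((HasPderivAt.coord i j x).mul (HasPderivAt.const i x (kd k l))).add
        ((HasPderivAt.coord i k x).mul (HasPderivAt.const i x (kd j l))))).add
      ((HasPderivAt.radial hx i hQ).mul
        ((HasPderivAt.const i x (kd j k)).mul (HasPderivAt.coord i l x)))).add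
      ((HasPderivAt.radial hx i hT).mul
        (((HasPderivAt.coord i j x).mul (HasPderivAt.coord i k x)).mul
          (HasPderivAt.coord i l x)))).congr
      (by filter_upwards [isOpen_ne.mem_nhds hx] with y hy using hs.christoffel_eq hy l j k)
      rfl).2
  -- The quadratic terms are regrouped by their dependence on `m` to fit `sum_three_mul_three`.
  have hm : ∀ m, g.christoffel l i m x * g.christoffel m j k x
        - g.christoffel l j m x * g.christoffel m i k x
      = (chrisP w ‖x‖ * x i * kd l m + chrisQ w ‖x‖ * x l * kd i m
          + (chrisP w ‖x‖ * kd i l + chrisT w ‖x‖ * (x i * x l)) * x m)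
        * (chrisP w ‖x‖ * x j * kd k m + chrisP w ‖x‖ * x k * kd j m
          + (chrisQ w ‖x‖ * kd j k + chrisT w ‖x‖ * (x j * x k)) * x m)
        - (chrisP w ‖x‖ * x j * kd l m + chrisQ w ‖x‖ * x l * kd j m
          + (chrisP w ‖x‖ * kd j l + chrisT w ‖x‖ * (x j * x l)) * x m)
        * (chrisP w ‖x‖ * x i * kd k m + chrisP w ‖x‖ * x k * kd i m
          + (chrisQ w ‖x‖ * kd i k + chrisT w ‖x‖ * (x i * x k)) * x m) := by
    intro m
    simp only [hs.christoffel_eq hx, kd_comm m l]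
    ring
  rw [riem, hd, hd]
  simp only [hm, Finset.sum_sub_distrib, sum_three_mul_three]
  rw [kd_comm j i, kd_comm k j, kd_comm k i, kd_comm k l]
  simp only [chrisT]
  simp only [chrisP, chrisQ]
  field_simp
  ring

end IsRotationallySymmetric

end RMetric

/-! ### Ricci, scalar and sectional curvatures, and the soliton equation. -/

/-- Sectional curvature of the planes containing the radial direction. -/
noncomputable def radialCurv (w : ℝ → ℝ) (r : ℝ) : ℝ := -deriv (deriv w) r / w r

/-- Sectional curvature of the planes tangent to the spheres about the origin. -/
noncomputable def sphericalCurv (w : ℝ → ℝ) (r : ℝ) : ℝ := (1 - deriv w r ^ 2) / w r ^ 2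

/-- Scalar curvature of `dr ⊗ dr + w(r)² g_can` in dimension `n`. -/
noncomputable def scalarCurv (n : ℕ) (w : ℝ → ℝ) (r : ℝ) : ℝ :=
  2 * ((n : ℝ) - 1) * radialCurv w r + ((n : ℝ) - 1) * ((n : ℝ) - 2) * sphericalCurv w r

lemma linearIndependent_single {n : ℕ} {i j : Fin n} (hij : i ≠ j) :
    LinearIndependent ℝ ![(EuclideanSpace.single i 1 : RSpace n), EuclideanSpace.single j 1] := by
  rw [LinearIndependent.pair_iff]
  intro s t h
  have h1 := congrArg (fun v : RSpace n => v i) h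
  have h2 := congrArg (fun v : RSpace n => v j) h
  simp [hij, hij.symm] at h1 h2
  exact ⟨h1, h2⟩

namespace RMetric

variable {n : ℕ}

/-- Since the `i`-th row of the metric is diagonal, lowering the last index leaves a single
curvature component, and `g_ii` cancels. -/
lemma sectional_single (g : RMetric n) {x : RSpace n} {i j : Fin n} (hij : i ≠ j)
    (hi : ∀ l, l ≠ i → g.coeff x i l = 0) :
    g.sectional x (EuclideanSpace.single i 1) (EuclideanSpace.single j 1)
      = g.riem i j j i x / g.coeff x j j := by
  have hii : g.coeff x i i ≠ 0 := (g.posDef x).diag_pos.ne'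
  rw [sectional, ip_single, ip_single, ip_single, hi j hij.symm]
  have h : ∀ l, g.riem i j j l x * g.coeff x l i = g.riem i j j i x * g.coeff x i i * kd i l := by
    intro l
    by_cases hl : l = i
    · rw [hl, kd_self, mul_one]
    · rw [kd_ne (Ne.symm hl), (g.posDef x).isHermitian.apply l i |>.symm, hi l hl]
      simp
  have h2 : (∑ a, ∑ b, ∑ k, ∑ l, ∑ m, (EuclideanSpace.single i (1 : ℝ) : RSpace n) a *
      (EuclideanSpace.single j (1 : ℝ) : RSpace n) b *
      (EuclideanSpace.single j (1 : ℝ) : RSpace n) k *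
      g.riem a b k l x * g.coeff x l m * (EuclideanSpace.single i (1 : ℝ) : RSpace n) m)
      = ∑ l, g.riem i j j l x * g.coeff x l i := by
    simp
  rw [h2, Finset.sum_congr rfl fun l _ => h l, ← Finset.mul_sum]
  rw [show ∑ l, kd i l = (1 : ℝ) by simp [kd], mul_one, zero_pow two_ne_zero, sub_zero,
    mul_comm (g.riem i j j i x), mul_div_mul_left _ _ hii]

namespace IsRotationallySymmetric

variable {g : RMetric n} {w : ℝ → ℝ} (hs : g.IsRotationallySymmetric w)

include hs

lemma ricci_eq {x : RSpace n} (hx : x ≠ 0) (j k : Fin n) :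
    g.ricci j k x = w ‖x‖ ^ 2 / ‖x‖ ^ 2 *
        (radialCurv w ‖x‖ + ((n : ℝ) - 2) * sphericalCurv w ‖x‖) * kd j k
      + (((n : ℝ) - 1) * radialCurv w ‖x‖ - w ‖x‖ ^ 2 / ‖x‖ ^ 2 *
        (radialCurv w ‖x‖ + ((n : ℝ) - 2) * sphericalCurv w ‖x‖)) / ‖x‖ ^ 2 * (x j * x k) := by
  have hn : 0 < ‖x‖ := norm_pos_iff.2 hx
  have hw := hs.2.1 _ hn
  rw [ricci]
  set U := (1 - deriv w ‖x‖ ^ 2) / ‖x‖ ^ 2 with hU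
  set V := (U + deriv (deriv w) ‖x‖ / w ‖x‖) / ‖x‖ ^ 2 with hV
  set W := (-(w ‖x‖ * deriv (deriv w) ‖x‖) / ‖x‖ ^ 2 - U) / ‖x‖ ^ 2 with hW
  have h : ∀ i, g.riem i j k i x = U * kd j k - U * (kd j i * kd k i)
      + V * x k * (kd j i * x i) - V * x k * x j + W * kd j k * (x i * x i)
      - W * x j * (kd k i * x i) := by
    intro i
    rw [hs.riem_eq hx, kd_self, kd_comm i k]
    ring
  simp only [h, Finset.sum_add_distrib, Finset.sum_sub_distrib, ← Finset.mul_sum, sum_kd_mul,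
    sum_coord_mul_self, Finset.sum_const, Finset.card_univ, Fintype.card_fin, nsmul_eq_mul]
  rw [kd_comm k j, hV, hW, hU, radialCurv, sphericalCurv]
  field_simp
  ring

lemma scalar_eq {x : RSpace n} (hx : x ≠ 0) : g.scalar x = scalarCurv n w ‖x‖ := by
  have hn : 0 < ‖x‖ := norm_pos_iff.2 hx
  have hw := hs.2.1 _ hn
  rw [scalar]
  simp only [hs.coeff_inv hx, hs.ricci_eq hx]
  set A := w ‖x‖ ^ 2 / ‖x‖ ^ 2 * (radialCurv w ‖x‖ + ((n : ℝ) - 2) * sphericalCurv w ‖x‖) with hA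
  set B := (((n : ℝ) - 1) * radialCurv w ‖x‖ - A) / ‖x‖ ^ 2 with hB
  set a := ‖x‖ ^ 2 / w ‖x‖ ^ 2 with ha
  have h : ∀ j k, (a * kd j k + (1 - a) / ‖x‖ ^ 2 * (x j * x k)) * (A * kd j k + B * (x j * x k))
      = (a * kd j k + 0 * kd j k + (1 - a) / ‖x‖ ^ 2 * x j * x k)
        * (A * kd j k + 0 * kd j k + B * x j * x k) := fun j k => by ring
  have h' : ∀ j, ∑ k, (a * kd j k + (1 - a) / ‖x‖ ^ 2 * (x j * x k))
      * (A * kd j k + B * (x j * x k))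
      = a * A + (a * B + (1 - a) / ‖x‖ ^ 2 * (A + B * ‖x‖ ^ 2)) * (x j * x j) := by
    intro j
    simp only [h, sum_three_mul_three, kd_self]
    ring
  simp only [h', Finset.sum_add_distrib, ← Finset.mul_sum, sum_coord_mul_self, Finset.sum_const,
    Finset.card_univ, Fintype.card_fin, nsmul_eq_mul]
  rw [hB, hA, ha, scalarCurv]
  field_simp
  ring

/-- Tests the plane of the first two axes at a point of the first axis, so that the plane contains
the radial direction. -/
lemma radialCurv_pos (hn : 3 ≤ n) (hpos : g.HasPositiveSectionalCurvature) {r : ℝ} (hr : 0 < r) :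
    0 < radialCurv w r := by
  let i : Fin n := ⟨0, by omega⟩
  let j : Fin n := ⟨1, by omega⟩
  have hij : i ≠ j := by simp [i, j]
  set x : RSpace n := EuclideanSpace.single i r
  have hx : x ≠ 0 := by simp [x, hr.ne']
  have hnorm : ‖x‖ = r := by simp [x, abs_of_pos hr]
  have hxi : x i = r := by simp [x]
  have hxl : ∀ l, l ≠ i → x l = 0 := fun l hl => by simp [x, hl]
  have hw := hs.2.1 r hr
  have h := hpos x _ _ (linearIndependent_single hij)
  rw [g.sectional_single hij (fun l hl => by
    rw [hs.coeff_eq hx, kd_ne hl.symm, hxl l hl]; ring), hs.riem_eq hx, hs.coeff_eq hx, hnorm,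
    kd_self, kd_self, kd_ne hij, kd_ne hij.symm, hxi, hxl j hij.symm] at h
  convert h using 1
  rw [radialCurv]
  field_simp
  ring

/-- Tests the same plane at a point of a third axis, which makes it tangent to the sphere; this is
where three dimensions enter. -/
lemma sphericalCurv_pos (hn : 3 ≤ n) (hpos : g.HasPositiveSectionalCurvature) {r : ℝ}
    (hr : 0 < r) : 0 < sphericalCurv w r := by
  let o : Fin n := ⟨2, by omega⟩
  let i : Fin n := ⟨0, by omega⟩
  let j : Fin n := ⟨1, by omega⟩
  have hij : i ≠ j := by simp [i, j]
  have hio : i ≠ o := by simp [i, o]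
  have hjo : j ≠ o := by simp [j, o]
  set x : RSpace n := EuclideanSpace.single o r
  have hx : x ≠ 0 := by simp [x, hr.ne']
  have hnorm : ‖x‖ = r := by simp [x, abs_of_pos hr]
  have hxl : ∀ l, l ≠ o → x l = 0 := fun l hl => by simp [x, hl]
  have hw := hs.2.1 r hr
  have h := hpos x _ _ (linearIndependent_single hij)
  rw [g.sectional_single hij (fun l hl => by
    rw [hs.coeff_eq hx, kd_ne hl.symm, hxl i hio]; ring), hs.riem_eq hx, hs.coeff_eq hx, hnorm,
    kd_self, kd_self, kd_ne hij, kd_ne hij.symm, hxl i hio, hxl j hjo] at h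
  convert h using 1
  rw [sphericalCurv]
  field_simp
  ring

/-- The soliton equation as a formula for the second derivatives of the potential. -/
lemma pderivAt_pderivAt_eq {f : RSpace n → ℝ} {ρ : ℝ} (hsol : g.IsGradientEinsteinSoliton f ρ 0)
    {x : RSpace n} (hx : x ≠ 0) :
    ∃ A B : ℝ, A = w ‖x‖ ^ 2 / ‖x‖ ^ 2 * (ρ * scalarCurv n w ‖x‖ - radialCurv w ‖x‖
        - ((n : ℝ) - 2) * sphericalCurv w ‖x‖) ∧
      A + B * ‖x‖ ^ 2 = ρ * scalarCurv n w ‖x‖ - ((n : ℝ) - 1) * radialCurv w ‖x‖ ∧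
      ∀ i j, pderivAt i (pderivAt j f) x
        = chrisP w ‖x‖ * (x i * pderivAt j f x + x j * pderivAt i f x)
          + (chrisQ w ‖x‖ * kd i j + chrisT w ‖x‖ * (x i * x j)) * ∑ k, x k * pderivAt k f x
          + A * kd i j + B * (x i * x j) := by
  have hn : 0 < ‖x‖ := norm_pos_iff.2 hx
  have hw := hs.2.1 _ hn
  set A := w ‖x‖ ^ 2 / ‖x‖ ^ 2 * (ρ * scalarCurv n w ‖x‖ - radialCurv w ‖x‖
        - ((n : ℝ) - 2) * sphericalCurv w ‖x‖) with hA
  refine ⟨A, (ρ * scalarCurv n w ‖x‖ - ((n : ℝ) - 1) * radialCurv w ‖x‖ - A) / ‖x‖ ^ 2, rfl,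
    by field_simp; ring, fun i j => ?_⟩
  have h := hsol.2 i j x
  have hk : ∀ k, g.christoffel k i j x * pderivAt k f x
      = chrisP w ‖x‖ * x i * (kd j k * pderivAt k f x)
        + chrisP w ‖x‖ * x j * (kd i k * pderivAt k f x)
        + (chrisQ w ‖x‖ * kd i j + chrisT w ‖x‖ * (x i * x j)) * (x k * pderivAt k f x) := by
    intro k
    rw [hs.christoffel_eq hx]
    ring
  rw [hessian] at h
  simp only [hk, Finset.sum_add_distrib, ← Finset.mul_sum, sum_kd_mul] at h
  rw [hs.ricci_eq hx, hs.coeff_eq hx, hs.scalar_eq hx] at h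
  rw [hA]
  linear_combination h
end IsRotationallySymmetric

end RMetric

/-! ### Radial symmetry of the potential. -/

/-- The circle of radius `r` spanned by two orthonormal vectors. -/
noncomputable def circ {n : ℕ} (e e' : RSpace n) (s : ℝ) : RSpace n :=
  Real.cos s • e + Real.sin s • e'

lemma hasDerivAt_circ {n : ℕ} (e e' : RSpace n) (s : ℝ) :
    HasDerivAt (circ e e') (circ e' (-e) s) s := by
  have h := ((Real.hasDerivAt_cos s).smul_const e).add ((Real.hasDerivAt_sin s).smul_const e')
  refine h.congr_deriv ?_
  simp [circ]
  abel

lemma hasDerivAt_comp_ray {n : ℕ} {F : Type*} [NormedAddCommGroup F] [NormedSpace ℝ F]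
    {Φ : RSpace n → F} (hΦ : Differentiable ℝ Φ) (e : RSpace n) (r : ℝ) :
    HasDerivAt (fun r : ℝ => Φ (r • e)) (fderiv ℝ Φ (r • e) e) r := by
  have h : HasDerivAt (fun r : ℝ => Φ (r • e)) (fderiv ℝ Φ (r • e) ((1 : ℝ) • e)) r :=
    (hΦ (r • e)).hasFDerivAt.comp_hasDerivAt r ((hasDerivAt_id r).smul_const e)
  rwa [one_smul] at h

lemma hasDerivAt_comp_circ {n : ℕ} {F : Type*} [NormedAddCommGroup F] [NormedSpace ℝ F]
    {Φ : RSpace n → F} (hΦ : Differentiable ℝ Φ) (e e' : RSpace n) (r s : ℝ) :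
    HasDerivAt (fun s => Φ (r • circ e e' s))
      (fderiv ℝ Φ (r • circ e e' s) (r • circ e' (-e) s)) s :=
  (hΦ (r • circ e e' s)).hasFDerivAt.comp_hasDerivAt s ((hasDerivAt_circ e e' s).const_smul r)

section

variable {n : ℕ} {e e' : RSpace n} (he : ‖e‖ = 1) (he' : ‖e'‖ = 1) (hee : inner ℝ e e' = 0)

include he he' hee

lemma norm_circ (s : ℝ) : ‖circ e e' s‖ = 1 := by
  rw [← sq_eq_sq₀ (norm_nonneg _) one_pos.le, circ, norm_add_sq_real, norm_smul, norm_smul,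
    inner_smul_left, inner_smul_right, hee, he, he']
  simp

lemma norm_circ_deriv (s : ℝ) : ‖circ e' (-e) s‖ = 1 :=
  norm_circ he' (by rwa [norm_neg]) (by rw [inner_neg_right, real_inner_comm, hee, neg_zero]) s

lemma inner_circ_deriv (s : ℝ) : inner ℝ (circ e e' s) (circ e' (-e) s) = 0 := by
  simp only [circ, inner_add_left, inner_add_right, inner_smul_left, inner_smul_right,
    inner_neg_right, hee, real_inner_comm e e', real_inner_self_eq_norm_sq, he, he',
    RCLike.conj_to_real]
  ring

end

namespace RMetric

variable {n : ℕ}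

namespace IsRotationallySymmetric

variable {g : RMetric n} {w : ℝ → ℝ} (hs : g.IsRotationallySymmetric w)
  {f : RSpace n → ℝ} {ρ : ℝ} (hsol : g.IsGradientEinsteinSoliton f ρ 0)

include hs hsol

/-- Both sides are bilinear, so agreement on coordinate vectors suffices. The basis-free form can be
evaluated on frames adapted to the sphere through `x`. -/
lemma fderiv_fderiv_eq {x : RSpace n} (hx : x ≠ 0) :
    ∃ A B : ℝ, A = w ‖x‖ ^ 2 / ‖x‖ ^ 2 * (ρ * scalarCurv n w ‖x‖ - radialCurv w ‖x‖
        - ((n : ℝ) - 2) * sphericalCurv w ‖x‖) ∧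
      A + B * ‖x‖ ^ 2 = ρ * scalarCurv n w ‖x‖ - ((n : ℝ) - 1) * radialCurv w ‖x‖ ∧
      ∀ u v, fderiv ℝ (fderiv ℝ f) x u v
        = chrisP w ‖x‖ * (inner ℝ x u * fderiv ℝ f x v + inner ℝ x v * fderiv ℝ f x u)
          + (chrisQ w ‖x‖ * inner ℝ u v + chrisT w ‖x‖ * (inner ℝ x u * inner ℝ x v))
            * fderiv ℝ f x x
          + A * inner ℝ u v + B * (inner ℝ x u * inner ℝ x v) := by
  obtain ⟨A, B, hA, hB, h⟩ := hs.pderivAt_pderivAt_eq hsol hx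
  refine ⟨A, B, hA, hB, ?_⟩
  have hd : DifferentiableAt ℝ (fderiv ℝ f) x :=
    (hsol.1.fderiv_right (m := ∞) (by simp)).differentiable (by simp) x
  have hp : ∀ i j, pderivAt i (pderivAt j f) x
      = fderiv ℝ (fderiv ℝ f) x (EuclideanSpace.single i 1) (EuclideanSpace.single j 1) := by
    intro i j
    rw [pderivAt]
    have := (hd.hasFDerivAt.clm_apply
      (hasFDerivAt_const (EuclideanSpace.single j (1 : ℝ) : RSpace n) x)).fderiv
    have e : fderiv ℝ (pderivAt j f) x = _ := this
    rw [e]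
    simp
  have hE : ∑ k, x k * pderivAt k f x = fderiv ℝ f x x := by
    have hxs : x = ∑ k, x k • (EuclideanSpace.single k 1 : RSpace n) := by
      have := (EuclideanSpace.basisFun (Fin n) ℝ).sum_repr x
      simpa using this.symm
    conv_rhs => rw [hxs, map_sum]
    simp only [map_smul, smul_eq_mul, ← hxs]
    rfl
  let R : RSpace n →ₗ[ℝ] RSpace n →ₗ[ℝ] ℝ := LinearMap.mk₂ ℝ (fun u v =>
      chrisP w ‖x‖ * (inner ℝ x u * fderiv ℝ f x v + inner ℝ x v * fderiv ℝ f x u)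
          + (chrisQ w ‖x‖ * inner ℝ u v + chrisT w ‖x‖ * (inner ℝ x u * inner ℝ x v))
            * fderiv ℝ f x x
          + A * inner ℝ u v + B * (inner ℝ x u * inner ℝ x v))
    (by intros; simp only [inner_add_left, inner_add_right, map_add]; ring)
    (by intros; simp only [inner_smul_left, inner_smul_right, map_smul, smul_eq_mul,
          RCLike.conj_to_real]; ring)
    (by intros; simp only [inner_add_right, map_add]; ring)
    (by intros; simp only [inner_smul_right, map_smul, smul_eq_mul]; ring)
  let H : RSpace n →ₗ[ℝ] RSpace n →ₗ[ℝ] ℝ := LinearMap.mk₂ ℝ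
    (fun u v => fderiv ℝ (fderiv ℝ f) x u v) (by simp) (by simp) (by simp) (by simp)
  have key : H = R := by
    refine LinearMap.ext_basis (EuclideanSpace.basisFun (Fin n) ℝ).toBasis
      (EuclideanSpace.basisFun (Fin n) ℝ).toBasis fun i j => ?_
    simp only [OrthonormalBasis.coe_toBasis, EuclideanSpace.basisFun_apply]
    rw [LinearMap.mk₂_apply, LinearMap.mk₂_apply, ← hp, h, hE]
    simp [EuclideanSpace.inner_single_right, pderivAt, kd, eq_comm]
  intro u v
  exact congrArg (fun L : RSpace n →ₗ[ℝ] RSpace n →ₗ[ℝ] ℝ => L u v) key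

variable {r : ℝ} {e e' : RSpace n}

lemma fderiv_fderiv_radial (hr : 0 < r) (he : ‖e‖ = 1) :
    fderiv ℝ (fderiv ℝ f) (r • e) e e
      = ρ * scalarCurv n w r - ((n : ℝ) - 1) * radialCurv w r := by
  have hx : r • e ≠ 0 := smul_ne_zero hr.ne' (norm_ne_zero_iff.1 (by rw [he]; exact one_ne_zero))
  have hn : ‖r • e‖ = r := by rw [norm_smul, he, Real.norm_eq_abs, abs_of_pos hr, mul_one]
  obtain ⟨A, B, -, hB, h⟩ := hs.fderiv_fderiv_eq hsol hx
  rw [hn] at hB h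
  rw [h, ← hB, inner_smul_left, real_inner_self_eq_norm_sq, he, map_smul, chrisT]
  simp
  field_simp
  ring

/-- Neither `Ric` nor `g` has a component pairing radial with tangential directions, so only the
Christoffel term survives. -/
lemma fderiv_fderiv_mixed (hr : 0 < r) (he : ‖e‖ = 1) (hee : inner ℝ e e' = 0) :
    fderiv ℝ (fderiv ℝ f) (r • e) e e' = chrisP w r * r * fderiv ℝ f (r • e) e' := by
  have hx : r • e ≠ 0 := smul_ne_zero hr.ne' (norm_ne_zero_iff.1 (by rw [he]; exact one_ne_zero))
  have hn : ‖r • e‖ = r := by rw [norm_smul, he, Real.norm_eq_abs, abs_of_pos hr, mul_one]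
  obtain ⟨A, B, -, -, h⟩ := hs.fderiv_fderiv_eq hsol hx
  rw [hn] at h
  rw [h, inner_smul_left, inner_smul_left, real_inner_self_eq_norm_sq, he, hee]
  simp
  ring

/-- The left side is the second derivative of `f` along the circle of radius `r` leaving `r • e` in
direction `e'`, including the acceleration term. -/
lemma fderiv_fderiv_spherical (hr : 0 < r) (he : ‖e‖ = 1) (he' : ‖e'‖ = 1)
    (hee : inner ℝ e e' = 0) :
    r ^ 2 * fderiv ℝ (fderiv ℝ f) (r • e) e' e' - r * fderiv ℝ f (r • e) e
      = -(w r * deriv w r * fderiv ℝ f (r • e) e) + w r ^ 2 * (ρ * scalarCurv n w r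
        - radialCurv w r - ((n : ℝ) - 2) * sphericalCurv w r) := by
  have hx : r • e ≠ 0 := smul_ne_zero hr.ne' (norm_ne_zero_iff.1 (by rw [he]; exact one_ne_zero))
  have hn : ‖r • e‖ = r := by rw [norm_smul, he, Real.norm_eq_abs, abs_of_pos hr, mul_one]
  obtain ⟨A, B, hA, -, h⟩ := hs.fderiv_fderiv_eq hsol hx
  rw [hn] at h hA
  rw [h, hA, inner_smul_left, real_inner_self_eq_norm_sq, he', hee, map_smul, chrisQ]
  simp
  field_simp
  ring

omit hs in
lemma differentiable_fderiv : Differentiable ℝ (fderiv ℝ f) :=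
  (hsol.1.fderiv_right (m := ∞) (by simp)).differentiable (by simp)

omit hs in
lemma hasDerivAt_ray (e : RSpace n) (r : ℝ) :
    HasDerivAt (fun r : ℝ => f (r • e)) (fderiv ℝ f (r • e) e) r :=
  hasDerivAt_comp_ray (hsol.1.differentiable (by simp)) e r

omit hs in
lemma hasDerivAt_fderiv_ray (e v : RSpace n) (r : ℝ) :
    HasDerivAt (fun r : ℝ => fderiv ℝ f (r • e) v) (fderiv ℝ (fderiv ℝ f) (r • e) e v) r := by
  have h := (hasDerivAt_comp_ray (differentiable_fderiv hsol) e r).clm_apply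
    (hasDerivAt_const r v)
  exact h.congr_deriv (by rw [map_zero, add_zero])

omit hs in
lemma hasDerivAt_circ_apply (e e' : RSpace n) (r s : ℝ) :
    HasDerivAt (fun s => f (r • circ e e' s))
      (r * fderiv ℝ f (r • circ e e' s) (circ e' (-e) s)) s := by
  have h := hasDerivAt_comp_circ (hsol.1.differentiable (by simp)) e e' r s
  exact h.congr_deriv (by rw [map_smul, smul_eq_mul])

omit hs in
lemma hasDerivAt_fderiv_circ_apply (e e' : RSpace n) (r s : ℝ) :
    HasDerivAt (fun s => fderiv ℝ f (r • circ e e' s) (circ e' (-e) s))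
      (r * fderiv ℝ (fderiv ℝ f) (r • circ e e' s) (circ e' (-e) s) (circ e' (-e) s)
        - fderiv ℝ f (r • circ e e' s) (circ e e' s)) s := by
  have h := (hasDerivAt_comp_circ (differentiable_fderiv hsol) e e' r s).clm_apply
    (hasDerivAt_circ e' (-e) s)
  refine h.congr_deriv ?_
  have : circ (-e) (-e') s = -circ e e' s := by simp [circ]; abel
  rw [this, map_smul, map_neg, smul_apply, smul_eq_mul, sub_eq_add_neg]

/-- The angular derivative of the potential is proportional to the warping factor. -/
lemma angular_derivative_eq (hr : 0 < r) (he : ‖e‖ = 1) (hee : inner ℝ e e' = 0) :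
    r * fderiv ℝ f (r • e) e' = w r * (fderiv ℝ f ((1 : ℝ) • e) e' / w 1) := by
  -- Here `chrisP w r * r = w'/w - 1/r`, so the mixed equation is linear in `r` with solutions
  -- proportional to `w/r`.
  have key : ∀ r ∈ Set.Ioi (0 : ℝ), HasDerivAt (fun r => r * fderiv ℝ f (r • e) e' / w r) 0 r := by
    intro r hr
    have hr : 0 < r := hr
    have hw := hs.2.1 r hr
    have h := ((hasDerivAt_id' r).fun_mul (hasDerivAt_fderiv_ray hsol e e' r)).fun_div
      (hs.hasDerivAt hr) hw.ne'
    refine h.congr_deriv ?_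
    rw [hs.fderiv_fderiv_mixed hsol hr he hee, chrisP]
    field_simp
    ring
  have h := isOpen_Ioi.is_const_of_deriv_eq_zero isPreconnected_Ioi
    (fun r hr => (key r hr).differentiableAt.differentiableWithinAt)
    (fun r hr => (key r hr).deriv) (Set.mem_Ioi.2 hr) (Set.mem_Ioi.2 one_pos)
  have hw := hs.2.1 r hr
  field_simp at h ⊢
  linarith

/-- Angular separation of variables: the defect from radial symmetry is `w(r) D(s)` with `D' = C`.
The spherical equation yields `C'(s) - C'(0) = -w'(r)² D(s)` for every `r`; two radii with different
`w'²` force `D = 0`. -/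
lemma apply_circ_eq (hmono : deriv w 1 ^ 2 ≠ deriv w 2 ^ 2) (hr : 0 < r) (he : ‖e‖ = 1)
    (he' : ‖e'‖ = 1) (hee : inner ℝ e e' = 0) (s : ℝ) : f (r • circ e e' s) = f (r • e) := by
  have n1 := norm_circ he he' hee
  have n2 := norm_circ_deriv he he' hee
  have n3 := inner_circ_deriv he he' hee
  have c0 : circ e e' 0 = e := by simp [circ]
  set C : ℝ → ℝ := fun s => fderiv ℝ f ((1 : ℝ) • circ e e' s) (circ e' (-e) s) / w 1 with hC
  set D : ℝ → ℝ := fun s => (f ((1 : ℝ) • circ e e' s) - f ((1 : ℝ) • e)) / w 1 with hD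
  -- The radius `1` serves as reference, so the angular profile `C` does not depend on `r`.
  have hang : ∀ r, 0 < r → ∀ s, r * fderiv ℝ f (r • circ e e' s) (circ e' (-e) s) = w r * C s :=
    fun r hr s => hs.angular_derivative_eq hsol hr (n1 s) (n3 s)
  have hF : ∀ r, 0 < r → ∀ s, f (r • circ e e' s) = f (r • e) + w r * D s := by
    intro r hr s
    have hd : ∀ s, HasDerivAt (fun s => f (r • circ e e' s) - w r * D s) 0 s := by
      intro s
      have h := (hasDerivAt_circ_apply hsol e e' r s).fun_sub
        ((((hasDerivAt_circ_apply hsol e e' 1 s).sub_const (f ((1 : ℝ) • e))).div_const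
          (w 1)).const_mul (w r))
      refine h.congr_deriv ?_
      rw [hang r hr, hC]
      ring
    have h := is_const_of_deriv_eq_zero (fun s => (hd s).differentiableAt)
      (fun s => (hd s).deriv) s 0
    simp only [hD, c0] at h ⊢
    linear_combination h
  have hFr : ∀ r, 0 < r → ∀ s, fderiv ℝ f (r • circ e e' s) (circ e e' s)
      = fderiv ℝ f (r • e) e + deriv w r * D s := by
    intro r hr s
    have h1 := hasDerivAt_ray hsol (circ e e' s) r
    have h2 := (hasDerivAt_ray hsol e r).fun_add ((hs.hasDerivAt hr).mul_const (D s))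
    exact h1.unique (h2.congr_of_eventuallyEq
      (by filter_upwards [Ioi_mem_nhds hr] with t ht using hF t ht s))
  have hC' : ∀ r, 0 < r → ∀ s, deriv C s = -(deriv w r * (fderiv ℝ f (r • e) e + deriv w r * D s))
      + w r * (ρ * scalarCurv n w r - radialCurv w r - ((n : ℝ) - 2) * sphericalCurv w r) := by
    intro r hr s
    have hw := hs.2.1 r hr
    have e1 : C = fun s => r * fderiv ℝ f (r • circ e e' s) (circ e' (-e) s) / w r := by
      funext s
      rw [hang r hr]
      field_simp
    rw [e1, (((hasDerivAt_fderiv_circ_apply hsol e e' r s).const_mul r).div_const (w r)).deriv,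
      ← hFr r hr]
    have h := hs.fderiv_fderiv_spherical hsol hr (n1 s) (n2 s) (n3 s)
    field_simp
    linear_combination h
  have hD0 : D 0 = 0 := by simp [hD, c0]
  have a1 := hC' 1 one_pos s
  have a2 := hC' 2 two_pos s
  have b1 := hC' 1 one_pos 0
  have b2 := hC' 2 two_pos 0
  rw [hD0] at b1 b2
  -- Subtracting the values at angle `0` removes all terms depending on `r` alone.
  have : (deriv w 1 ^ 2 - deriv w 2 ^ 2) * D s = 0 := by linear_combination a1 - a2 + b2 - b1
  rw [hF r hr, (mul_eq_zero.1 this).resolve_left (sub_ne_zero.2 hmono)]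
  ring

end IsRotationallySymmetric

end RMetric

/-- Gram–Schmidt applied to `e, y`, with angle `arccos ⟨e, y⟩`; thus invariance along circles gives
invariance on spheres. -/
lemma exists_circ {n : ℕ} (hn : 3 ≤ n) {e y : RSpace n} (he : ‖e‖ = 1) (hy : ‖y‖ = 1) :
    ∃ (e' : RSpace n) (s : ℝ), ‖e'‖ = 1 ∧ inner ℝ e e' = 0 ∧ y = circ e e' s := by
  set a : ℝ := inner ℝ e y with ha
  set z := y - a • e with hz
  have hez : inner ℝ e z = 0 := by
    rw [hz, inner_sub_right, inner_smul_right, real_inner_self_eq_norm_sq, he, ← ha]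
    ring
  have hsum : a ^ 2 + ‖z‖ ^ 2 = 1 := by
    have h : y = a • e + z := by rw [hz]; abel
    have h2 : ‖y‖ ^ 2 = ‖a • e + z‖ ^ 2 := by rw [← h]
    rw [norm_add_sq_real, inner_smul_left, hez, norm_smul, he, hy] at h2
    simp at h2
    linarith
  have hcos : Real.cos (Real.arccos a) = a :=
    Real.cos_arccos (by nlinarith [norm_nonneg z]) (by nlinarith [norm_nonneg z])
  have hsin : Real.sin (Real.arccos a) = ‖z‖ := by
    rw [Real.sin_arccos, show 1 - a ^ 2 = ‖z‖ ^ 2 by linarith, Real.sqrt_sq (norm_nonneg z)]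
  obtain ⟨e', h1, h2, h3⟩ : ∃ e' : RSpace n, ‖e'‖ = 1 ∧ inner ℝ e e' = 0 ∧ z = ‖z‖ • e' := by
    -- If `y = ±e`, the second direction is arbitrary and exists by dimension count.
    by_cases hz0 : z = 0
    · obtain ⟨v, hv, hv0⟩ : ∃ v ∈ (ℝ ∙ e)ᗮ, v ≠ 0 := by
        apply Submodule.exists_mem_ne_zero_of_ne_bot
        intro hb
        have h1 := Submodule.finrank_add_finrank_orthogonal (ℝ ∙ e)
        rw [hb, finrank_bot, finrank_euclideanSpace_fin] at h1
        have := finrank_span_singleton (K := ℝ) (norm_ne_zero_iff.1 (he ▸ one_ne_zero) : e ≠ 0)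
        omega
      refine ⟨‖v‖⁻¹ • v, norm_smul_inv_norm hv0, ?_, by simp [hz0]⟩
      rw [inner_smul_right, Submodule.mem_orthogonal_singleton_iff_inner_right.1 hv, mul_zero]
    · refine ⟨‖z‖⁻¹ • z, norm_smul_inv_norm hz0, by rw [inner_smul_right, hez, mul_zero], ?_⟩
      rw [smul_smul, mul_inv_cancel₀ (norm_ne_zero_iff.2 hz0), one_smul]
  refine ⟨e', Real.arccos a, h1, h2, ?_⟩
  rw [circ, hcos, hsin, ← h3, hz]
  abel

namespace RMetric.IsRotationallySymmetric

variable {n : ℕ} {g : RMetric n} {w : ℝ → ℝ} (hs : g.IsRotationallySymmetric w)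
  {f : RSpace n → ℝ} {ρ : ℝ} (hsol : g.IsGradientEinsteinSoliton f ρ 0)

include hs hsol

lemma apply_eq_of_norm_eq (hn : 3 ≤ n) (hmono : deriv w 1 ^ 2 ≠ deriv w 2 ^ 2) {x y : RSpace n}
    (hxy : ‖x‖ = ‖y‖) : f x = f y := by
  by_cases hx : x = 0
  · rw [hx, norm_zero, eq_comm, norm_eq_zero] at hxy
    rw [hx, hxy]
  have hr : 0 < ‖x‖ := norm_pos_iff.2 hx
  have hy : y ≠ 0 := norm_ne_zero_iff.1 (hxy ▸ hr.ne')
  obtain ⟨e', s, h1, h2, h3⟩ := exists_circ hn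
    (norm_smul_inv_norm (𝕜 := ℝ) hx) (norm_smul_inv_norm (𝕜 := ℝ) hy)
  have h := hs.apply_circ_eq hsol hmono hr (norm_smul_inv_norm (𝕜 := ℝ) hx) h1 h2 s
  rw [← h3] at h
  simp only [RCLike.ofReal_real_eq_id, id_eq] at h
  rw [smul_smul, smul_smul, ← hxy, mul_inv_cancel₀ hr.ne', one_smul, one_smul] at h
  exact h.symm

/-- The potential is a function of the distance to the origin, subject to the soliton ODEs. -/
lemma exists_radial_potential (hn : 3 ≤ n) (hmono : deriv w 1 ^ 2 ≠ deriv w 2 ^ 2) :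
    ∃ φ φ' : ℝ → ℝ, (∀ x, f x = φ ‖x‖) ∧ (∀ r, 0 < r → HasDerivAt φ (φ' r) r) ∧
      (∀ r, 0 < r → HasDerivAt φ'
        (ρ * scalarCurv n w r - ((n : ℝ) - 1) * radialCurv w r) r) ∧
      ∀ r, 0 < r → w r * deriv w r * φ' r = w r ^ 2 * (ρ * scalarCurv n w r
        - radialCurv w r - ((n : ℝ) - 2) * sphericalCurv w r) := by
  let e : RSpace n := EuclideanSpace.single ⟨0, by omega⟩ 1
  have he : ‖e‖ = 1 := by simp [e]
  obtain ⟨e', -, he', hee, -⟩ := exists_circ hn he he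
  refine ⟨fun r => f (r • e), fun r => fderiv ℝ f (r • e) e, fun x => ?_, fun r _ =>
    hasDerivAt_ray hsol e r, fun r hr => ?_, fun r hr => ?_⟩
  · exact hs.apply_eq_of_norm_eq hsol hn hmono (by simp [norm_smul, he])
  · rw [← hs.fderiv_fderiv_radial hsol hr he]
    exact hasDerivAt_fderiv_ray hsol e e r
  · have c0 : circ e e' 0 = e := by simp [circ]
    have c1 : circ e' (-e) 0 = e' := by simp [circ]
    have h1 : ∀ s, fderiv ℝ f (r • circ e e' s) (circ e' (-e) s) = 0 := by
      intro s
      have ha := hasDerivAt_circ_apply hsol e e' r s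
      have hb : (fun s => f (r • circ e e' s)) = fun _ => f (r • e) := by
        funext s
        exact hs.apply_circ_eq hsol hmono hr he he' hee s
      rw [hb] at ha
      exact (mul_eq_zero.1 (ha.unique (hasDerivAt_const s _))).resolve_left hr.ne'
    have h2 := hasDerivAt_fderiv_circ_apply hsol e e' r 0
    simp only [h1] at h2
    have h3 := h2.unique (hasDerivAt_const 0 _)
    rw [c0, c1] at h3
    have h4 := hs.fderiv_fderiv_spherical hsol hr he he' hee
    linear_combination h4 - r * h3

end RMetric.IsRotationallySymmetric

/-! ### Calculus of two-sided asymptotic bounds. -/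

namespace TwoSidedO

lemma of_eventually {u v : ℝ → ℝ} {A B : ℝ} (hA : 0 < A) (hB : 0 < B)
    (hv : ∀ᶠ r in atTop, 0 < v r) (h : ∀ᶠ r in atTop, A * v r ≤ u r ∧ u r ≤ B * v r) :
    TwoSidedO u v := by
  obtain ⟨R, hR⟩ := eventually_atTop.1 (hv.and h)
  -- The factors `1/2` and `2` turn weak inequalities into strict ones; the maximum with `1` makes
  -- the threshold positive.
  refine ⟨A / 2, 2 * B, max R 1, by positivity, by positivity, by positivity, fun r hr => ?_⟩
  obtain ⟨h0, h1, h2⟩ := hR r ((le_max_left _ _).trans hr.le)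
  constructor
  · nlinarith [mul_pos hA h0]
  · nlinarith [mul_pos hB h0]

lemma eventually {u v : ℝ → ℝ} (h : TwoSidedO u v) :
    ∃ A B : ℝ, 0 < A ∧ 0 < B ∧ ∀ᶠ r in atTop, A * v r ≤ u r ∧ u r ≤ B * v r := by
  obtain ⟨A, B, R, hA, hB, -, h⟩ := h
  refine ⟨A, B, hA, hB, ?_⟩
  filter_upwards [eventually_gt_atTop R] with r hr using ⟨(h r hr).1.le, (h r hr).2.le⟩

lemma eventually_pos {u v : ℝ → ℝ} (h : TwoSidedO u v) (hv : ∀ᶠ r in atTop, 0 < v r) :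
    ∀ᶠ r in atTop, 0 < u r := by
  obtain ⟨A, B, hA, -, h⟩ := h.eventually
  filter_upwards [h, hv] with r h1 h2
  exact (mul_pos hA h2).trans_le h1.1

lemma congr {u u' v v' : ℝ → ℝ} (h : TwoSidedO u v) (hv : ∀ᶠ r in atTop, 0 < v r)
    (hu : u =ᶠ[atTop] u') (hv' : v =ᶠ[atTop] v') : TwoSidedO u' v' := by
  obtain ⟨A, B, hA, hB, h⟩ := h.eventually
  refine of_eventually hA hB ?_ ?_
  · filter_upwards [hv, hv'] with r h1 h2
    rwa [← h2]
  · filter_upwards [h, hu, hv'] with r h1 h2 h3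
    rwa [← h2, ← h3]

lemma mul {u₁ u₂ v₁ v₂ : ℝ → ℝ} (h₁ : TwoSidedO u₁ v₁) (h₂ : TwoSidedO u₂ v₂)
    (hv₁ : ∀ᶠ r in atTop, 0 < v₁ r) (hv₂ : ∀ᶠ r in atTop, 0 < v₂ r) :
    TwoSidedO (fun r => u₁ r * u₂ r) (fun r => v₁ r * v₂ r) := by
  have p₂ := h₂.eventually_pos hv₂
  obtain ⟨A, B, hA, hB, h⟩ := h₁.eventually
  obtain ⟨A', B', hA', hB', h'⟩ := h₂.eventually
  refine of_eventually (mul_pos hA hA') (mul_pos hB hB')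
    (by filter_upwards [hv₁, hv₂] with r a b using mul_pos a b) ?_
  filter_upwards [h, h', hv₁, hv₂, p₂] with r a b c d e
  constructor
  · calc A * A' * (v₁ r * v₂ r) = (A * v₁ r) * (A' * v₂ r) := by ring
      _ ≤ u₁ r * u₂ r := mul_le_mul a.1 b.1 (by positivity) ((by positivity : 0 ≤ A * v₁ r).trans a.1)
  · calc u₁ r * u₂ r ≤ (B * v₁ r) * (B' * v₂ r) := mul_le_mul a.2 b.2 e.le (by positivity)
      _ = B * B' * (v₁ r * v₂ r) := by ring

lemma inv {u v : ℝ → ℝ} (h : TwoSidedO u v) (hv : ∀ᶠ r in atTop, 0 < v r) :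
    TwoSidedO (fun r => (u r)⁻¹) (fun r => (v r)⁻¹) := by
  have p := h.eventually_pos hv
  obtain ⟨A, B, hA, hB, h⟩ := h.eventually
  refine of_eventually (inv_pos.2 hB) (inv_pos.2 hA)
    (by filter_upwards [hv] with r a using inv_pos.2 a) ?_
  filter_upwards [h, hv, p] with r a c d
  rw [← mul_inv, ← mul_inv]
  exact ⟨inv_anti₀ d a.2, inv_anti₀ (by positivity) a.1⟩

lemma rpow {u v : ℝ → ℝ} (h : TwoSidedO u v) (hv : ∀ᶠ r in atTop, 0 < v r) {q : ℝ} (hq : 0 ≤ q) :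
    TwoSidedO (fun r => u r ^ q) (fun r => v r ^ q) := by
  have p := h.eventually_pos hv
  obtain ⟨A, B, hA, hB, h⟩ := h.eventually
  refine of_eventually (Real.rpow_pos_of_pos hA q) (Real.rpow_pos_of_pos hB q)
    (by filter_upwards [hv] with r a using Real.rpow_pos_of_pos a q) ?_
  filter_upwards [h, hv, p] with r a c d
  rw [← Real.mul_rpow hA.le c.le, ← Real.mul_rpow hB.le c.le]
  exact ⟨Real.rpow_le_rpow (by positivity) a.1 hq, Real.rpow_le_rpow d.le a.2 hq⟩

end TwoSidedO

lemma eventually_rpow_pos (p : ℝ) : ∀ᶠ r : ℝ in atTop, 0 < r ^ p := by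
  filter_upwards [eventually_gt_atTop 0] with r hr using Real.rpow_pos_of_pos hr p

lemma antitoneOn_Ici_of_hasDerivAt_nonpos {F F' : ℝ → ℝ} {a : ℝ}
    (h : ∀ r, a ≤ r → HasDerivAt F (F' r) r) (h' : ∀ r, a ≤ r → F' r ≤ 0) :
    AntitoneOn F (Set.Ici a) := by
  refine antitoneOn_of_deriv_nonpos (convex_Ici a)
    (fun r hr => (h r hr).continuousAt.continuousWithinAt)
    (fun r hr => ?_) (fun r hr => ?_)
  · rw [interior_Ici] at hr
    exact (h r hr.le).differentiableAt.differentiableWithinAt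
  · rw [interior_Ici] at hr
    rw [(h r hr.le).deriv]
    exact h' r hr.le

/-- Integration of a two-sided power bound. -/
lemma TwoSidedO.of_hasDerivAt {F F' : ℝ → ℝ} {p : ℝ} (hp : 0 < p + 1)
    (hF : ∀ r, 0 < r → HasDerivAt F (F' r) r) (h : TwoSidedO F' (fun r => r ^ p)) :
    TwoSidedO F (fun r => r ^ (p + 1)) := by
  obtain ⟨A, B, hA, hB, h⟩ := h.eventually
  obtain ⟨R, hR⟩ := eventually_atTop.1 (h.and (eventually_ge_atTop 1))
  have hR1 : 1 ≤ R := (hR R le_rfl).2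
  have hpow : ∀ r, R ≤ r → HasDerivAt (fun r : ℝ => r ^ (p + 1)) ((p + 1) * r ^ p) r := by
    intro r hr
    have := Real.hasDerivAt_rpow_const (x := r) (p := p + 1) (Or.inl (by linarith))
    rwa [add_sub_cancel_right] at this
  have hlow := antitoneOn_Ici_of_hasDerivAt_nonpos (a := R)
    (fun r hr => ((hpow r hr).const_mul (A / (p + 1))).fun_sub (hF r (by linarith)))
    (fun r hr => by
      have := (hR r hr).1.1
      field_simp
      linarith)
  have hup := antitoneOn_Ici_of_hasDerivAt_nonpos (a := R)
    (fun r hr => (hF r (by linarith)).fun_sub ((hpow r hr).const_mul (B / (p + 1))))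
    (fun r hr => by
      have := (hR r hr).1.2
      field_simp
      linarith)
  have ht : Tendsto (fun r : ℝ => r ^ (p + 1)) atTop atTop := tendsto_rpow_atTop hp
  set D₁ := A / (p + 1) * R ^ (p + 1) - F R
  set D₂ := F R - B / (p + 1) * R ^ (p + 1)
  have hA' : 0 < A / (p + 1) := by positivity
  have hB' : 0 < B / (p + 1) := by positivity
  refine TwoSidedO.of_eventually (A := A / (p + 1) / 2) (B := B / (p + 1) + 1) (by positivity)
    (by positivity) (eventually_rpow_pos _) ?_
  filter_upwards [eventually_ge_atTop R, ht.eventually_ge_atTop (D₁ / (A / (p + 1) / 2)),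
    ht.eventually_ge_atTop D₂] with r hr h1 h2
  have a1 := hlow Set.self_mem_Ici hr hr
  have a2 := hup Set.self_mem_Ici hr hr
  rw [div_le_iff₀ (by positivity)] at h1
  simp only at a1 a2
  constructor <;> linarith

/-- A function whose derivative is dominated by that of a bounded monotone function is bounded. -/
lemma abs_le_of_abs_deriv_le {L L' Φ Φ' : ℝ → ℝ} {a P : ℝ}
    (hL : ∀ r, a ≤ r → HasDerivAt L (L' r) r) (hΦ : ∀ r, a ≤ r → HasDerivAt Φ (Φ' r) r)
    (h : ∀ r, a ≤ r → |L' r| ≤ -Φ' r) (hP : ∀ r, a ≤ r → |Φ r| ≤ P) :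
    ∀ r, a ≤ r → |L r| ≤ |L a| + 2 * P := by
  intro r hr
  have up := antitoneOn_Ici_of_hasDerivAt_nonpos (fun r hr => (hL r hr).fun_add (hΦ r hr))
    (fun r hr => by linarith [(abs_le.1 (h r hr)).2]) Set.self_mem_Ici hr hr
  have low := antitoneOn_Ici_of_hasDerivAt_nonpos (fun r hr => (hΦ r hr).fun_sub (hL r hr))
    (fun r hr => by linarith [(abs_le.1 (h r hr)).1]) Set.self_mem_Ici hr hr
  simp only at up low
  have h1 := abs_le.1 (hP a le_rfl)
  have h2 := abs_le.1 (hP r hr)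
  have h3 := abs_le.1 (le_refl |L a|)
  rw [abs_le]
  constructor <;> linarith

/-! ### The ODE system for `m ≠ 1`. -/

/-- Here `K = -w w''` and `X = w'²`. The right side contains `K²`; the choice of `A₃` gives `A₃(1-X)
≥ 1`, hence at least `cX²`; and `A₁` is large enough that the coefficient of `KX` is at least `|e|`.
-/
lemma lyapunov_inequality {c b e K M X X₁ A₁ A₃ : ℝ} (hc : 1 ≤ c) (hb : 0 < b) (hK : 0 ≤ K)
    (hKM : K ≤ M) (hX : 0 ≤ X) (hXX : X ≤ X₁) (hX1 : X₁ < 1) (hA₃ : A₃ = 1 / (1 - X₁))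
    (hA₁ : A₁ = |e| * M / b + c / b + A₃ * (3 * M + b + |e|) + |e|) :
    |K ^ 2 - e * K * X + c * X ^ 2| ≤ -(-(K * X * (2 * A₁ - e * K / b - c * (1 - X) / b
        - A₃ * (3 * K + b - e * X))) - K ^ 3 / b - K ^ 2 - A₃ * (c * X ^ 2 * (1 - X))) := by
  have hX1' : 0 < 1 - X₁ := by linarith
  have hA₃0 : 0 < A₃ := by rw [hA₃]; positivity
  have hM : 0 ≤ M := hK.trans hKM
  have hA₁0 : 0 ≤ A₁ := by rw [hA₁]; positivity
  have t1 : e * K / b ≤ |e| * M / b := by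
    gcongr
    exact le_abs_self e
  have t2 : c * (1 - X) / b ≤ c / b :=
    div_le_div_of_nonneg_right (mul_le_of_le_one_right (by linarith) (by linarith)) hb.le
  have t3 : A₃ * (3 * K + b - e * X) ≤ A₃ * (3 * M + b + |e|) := by
    have : -e * X ≤ |e| * 1 := mul_le_mul (neg_le_abs e) (by linarith) hX (abs_nonneg e)
    exact mul_le_mul_of_nonneg_left (by linarith) hA₃0.le
  have t4 : c * X ^ 2 ≤ A₃ * (c * X ^ 2 * (1 - X)) := by
    have h : A₃ * (c * X ^ 2 * (1 - X₁)) = c * X ^ 2 := by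
      rw [hA₃]
      field_simp
    calc c * X ^ 2 = A₃ * (c * X ^ 2 * (1 - X₁)) := h.symm
      _ ≤ A₃ * (c * X ^ 2 * (1 - X)) := mul_le_mul_of_nonneg_left
        (mul_le_mul_of_nonneg_left (by linarith) (by positivity)) hA₃0.le
  have t5 : 0 ≤ K ^ 3 / b := by positivity
  have t6 : K * X * |e|
      ≤ K * X * (2 * A₁ - e * K / b - c * (1 - X) / b - A₃ * (3 * K + b - e * X)) :=
    mul_le_mul_of_nonneg_left (by linarith) (by positivity)
  have t7 : |e * (K * X)| = K * X * |e| := by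
    rw [abs_mul, abs_of_nonneg (by positivity : 0 ≤ K * X), mul_comm]
  have t8 := abs_le.1 t7.le
  have t9 : 0 ≤ c * X ^ 2 := by positivity
  have t10 : 0 ≤ K ^ 2 := sq_nonneg K
  rw [abs_le]
  constructor <;> linarith

/-- The ODE system satisfied by the warping factor `w` and the potential `φ` of a rotationally
symmetric steady gradient `ρ`-Einstein soliton of positive curvature in dimension `c + 2`, where
`m = (c + 1) ρ`. -/
structure SolitonODE (m c : ℝ) (w w₁ w₂ φ φ₁ φ₂ : ℝ → ℝ) : Prop where
  hasDerivAt_w : ∀ r, 0 < r → HasDerivAt w (w₁ r) r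
  hasDerivAt_w₁ : ∀ r, 0 < r → HasDerivAt w₁ (w₂ r) r
  hasDerivAt_φ : ∀ r, 0 < r → HasDerivAt φ (φ₁ r) r
  hasDerivAt_φ₁ : ∀ r, 0 < r → HasDerivAt φ₁ (φ₂ r) r
  w_pos : ∀ r, 0 < r → 0 < w r
  w₁_pos : ∀ r, 0 < r → 0 < w₁ r
  w₁_lt_one : ∀ r, 0 < r → w₁ r < 1
  w₂_neg : ∀ r, 0 < r → w₂ r < 0
  one_le_c : 1 ≤ c
  radial_eq : ∀ r, 0 < r →
    w r ^ 2 * φ₂ r = -((2 * m - c - 1) * (w r * w₂ r)) + m * c * (1 - w₁ r ^ 2)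
  spherical_eq : ∀ r, 0 < r →
    w r * w₁ r * φ₁ r = -((2 * m - 1) * (w r * w₂ r)) - (1 - m) * c * (1 - w₁ r ^ 2)

namespace SolitonODE

variable {m c : ℝ} {w w₁ w₂ φ φ₁ φ₂ : ℝ → ℝ} (H : SolitonODE m c w w₁ w₂ φ φ₁ φ₂)

include H

lemma w₁_le {r : ℝ} (hr : 1 ≤ r) : w₁ r ≤ w₁ 1 :=
  antitoneOn_Ici_of_hasDerivAt_nonpos (a := 1)
    (fun r hr => H.hasDerivAt_w₁ r (by linarith))
    (fun r hr => (H.w₂_neg r (by linarith)).le) Set.self_mem_Ici hr hr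

/-- Solve the spherical equation for `w w''`, differentiate, then remove `φ'` and `φ''` by the two
equations. This closes the system in `-w w''` and `w'²`. -/
lemma hasDerivAt_ww₂ (hm : 2 * m - 1 ≠ 0) {r : ℝ} (hr : 0 < r) :
    HasDerivAt (fun r => -(w r * w₂ r)) ((-(w r * w₂ r) ^ 2
      - (1 - m) * c / (1 - 2 * m) * -(w r * w₂ r)
      + (2 - m * c / (2 * m - 1)) * -(w r * w₂ r) * w₁ r ^ 2
      + c * w₁ r ^ 2 * (1 - w₁ r ^ 2)) / (w r * w₁ r)) r := by
  have hm' : 1 - 2 * m ≠ 0 := fun h => hm (by linarith)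
  have h := (((((H.hasDerivAt_w r hr).fun_mul (H.hasDerivAt_w₁ r hr)).fun_mul
    (H.hasDerivAt_φ₁ r hr)).fun_add
      ((((H.hasDerivAt_w₁ r hr).fun_pow 2).const_sub 1).const_mul ((1 - m) * c))).div_const
        (2 * m - 1)).congr_of_eventuallyEq
    (show (fun r => -(w r * w₂ r)) =ᶠ[𝓝 r] _ by
      filter_upwards [Ioi_mem_nhds hr] with s hs
      rw [H.spherical_eq s hs]
      field_simp
      ring)
  refine h.congr_deriv ?_
  have h1 := H.radial_eq r hr
  have h2 := H.spherical_eq r hr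
  have hw := H.w_pos r hr
  have hw₁ := H.w₁_pos r hr
  have e1 : m * c / (2 * m - 1) = -(m * c / (1 - 2 * m)) := by
    rw [← div_neg]; congr 1; ring
  rw [e1, div_eq_div_iff hm (by positivity)]
  have e2 : (w₁ r * w₁ r + w r * w₂ r) * φ₁ r * (w r * w₁ r)
      = (w₁ r ^ 2 + w r * w₂ r) * (w r * w₁ r * φ₁ r) := by ring
  have e3 : w r * w₁ r * φ₂ r * (w r * w₁ r) = w₁ r ^ 2 * (w r ^ 2 * φ₂ r) := by ring
  rw [add_mul, add_mul, e2, e3, h1, h2]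
  field_simp
  ring

/-- Boundedness of `-w w''`. -/
lemma exists_ww₂_le (hm : 2 * m - 1 ≠ 0) (hb : 0 < (1 - m) * c / (1 - 2 * m)) :
    ∃ M, ∀ r, 1 ≤ r → -(w r * w₂ r) ≤ M := by
  set e := 2 - m * c / (2 * m - 1) with he
  set b := (1 - m) * c / (1 - 2 * m) with hbd
  -- Large enough for `M²` to beat `|e|M + c`: the derivative of `-w w''` is negative whenever the
  -- level `M` is reached, so the level is never crossed.
  set M := max (-(w 1 * w₂ 1)) (|e| + c + 1) with hM
  have hc := H.one_le_c
  have hM1 : |e| + c + 1 ≤ M := le_max_right _ _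
  have hM0 : 0 < M := by have := abs_nonneg e; linarith
  refine ⟨M, fun r hr => ?_⟩
  have hd : ∀ s, 1 ≤ s → HasDerivAt (fun r => -(w r * w₂ r)) _ s :=
    fun s hs => H.hasDerivAt_ww₂ hm (by linarith)
  refine image_le_of_deriv_right_lt_deriv_boundary' (a := 1) (b := r) (B := fun _ => M)
    (B' := fun _ => 0) (fun s hs => (hd s hs.1).continuousAt.continuousWithinAt)
    (fun s hs => (hd s hs.1).hasDerivWithinAt) (le_max_left _ _) continuousOn_const
    (fun s hs => hasDerivWithinAt_const _ _ _) (fun s hs hK => ?_) ⟨hr, le_rfl⟩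
  have hs0 : 0 < s := by linarith [hs.1]
  have hw := H.w_pos s hs0
  have hw₁ := H.w₁_pos s hs0
  have hw₁' := H.w₁_lt_one s hs0
  refine div_neg_of_neg_of_pos ?_ (by positivity)
  rw [← neg_sq, hK]
  set X := w₁ s ^ 2
  have hX0 : 0 ≤ X := sq_nonneg _
  have hX1 : X ≤ 1 := by simp only [X]; nlinarith
  have h1 : e * M * X ≤ |e| * M := by
    have : e * M * X ≤ |e| * M * X := by gcongr; exact le_abs_self e
    exact this.trans (mul_le_of_le_one_right (by positivity) hX1)
  have h2 : c * X * (1 - X) ≤ c := by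
    rw [mul_assoc]
    exact mul_le_of_le_one_right (by linarith) (by nlinarith)
  have h3 : (|e| + c + 1) * M ≤ M * M := by gcongr
  have h4 : c ≤ c * M := le_mul_of_one_le_right (by linarith) (by linarith [abs_nonneg e])
  change -M ^ 2 - b * M + e * M * X + c * X * (1 - X) < 0
  linarith [mul_pos hb hM0]

/-- `w' w^γ` is bounded above and away from zero. -/
lemma exists_abs_log_le (hm : 2 * m - 1 ≠ 0) (hm' : m ≠ 1)
    (hb : 0 < (1 - m) * c / (1 - 2 * m)) :
    ∃ B, ∀ r, 1 ≤ r → |Real.log (w₁ r) + (1 - 2 * m) / (1 - m) * Real.log (w r)| ≤ B := by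
  obtain ⟨M, hM⟩ := H.exists_ww₂_le hm hb
  have hc := H.one_le_c
  have hm1 : 1 - 2 * m ≠ 0 := fun h => hm (by linarith)
  have hm2 : 1 - m ≠ 0 := fun h => hm' (by linarith)
  have hd := fun r (hr : (1 : ℝ) ≤ r) => H.hasDerivAt_ww₂ hm (r := r) (by linarith)
  generalize 2 - m * c / (2 * m - 1) = e at hd
  obtain ⟨b, hbd⟩ : ∃ b, b = (1 - m) * c / (1 - 2 * m) := ⟨_, rfl⟩
  have hγ : (1 - 2 * m) / (1 - m) = c / b := by rw [hbd]; field_simp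
  rw [hγ]
  rw [← hbd] at hb
  simp only [← hbd] at hd
  obtain ⟨K, hK⟩ : ∃ K : ℝ → ℝ, K = fun r => -(w r * w₂ r) := ⟨_, rfl⟩
  have hw := fun r (hr : (1 : ℝ) ≤ r) => H.w_pos r (by linarith)
  have hw₁ := fun r (hr : (1 : ℝ) ≤ r) => H.w₁_pos r (by linarith)
  have hK0 : ∀ r, 1 ≤ r → 0 < K r := by
    intro r hr
    rw [hK]
    nlinarith [H.w₂_neg r (by linarith), hw r hr]
  have hKM : ∀ r, 1 ≤ r → K r ≤ M := by rwa [hK]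
  have hM0 : 0 ≤ M := (hK0 1 le_rfl).le.trans (hKM 1 le_rfl)
  have hX1 : w₁ 1 ^ 2 < 1 := by nlinarith [hw₁ 1 le_rfl, H.w₁_lt_one 1 one_pos]
  have hXX : ∀ r, 1 ≤ r → w₁ r ^ 2 ≤ w₁ 1 ^ 2 := fun r hr =>
    pow_le_pow_left₀ (hw₁ r hr).le (H.w₁_le hr) 2
  have hKd : ∀ r, 1 ≤ r → HasDerivAt K ((-K r ^ 2 - b * K r + e * K r * w₁ r ^ 2
      + c * w₁ r ^ 2 * (1 - w₁ r ^ 2)) / (w r * w₁ r)) r := by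
    intro r hr
    rw [hK, neg_sq]
    exact hd r hr
  have hXd : ∀ r, 1 ≤ r → HasDerivAt (fun r => w₁ r ^ 2)
      (-2 * K r * w₁ r ^ 2 / (w r * w₁ r)) r := by
    intro r hr
    have := hw r hr
    have := hw₁ r hr
    refine ((H.hasDerivAt_w₁ r (by linarith)).fun_pow 2).congr_deriv ?_
    rw [hK]
    field_simp
    ring
  -- Subtracting `K/b` cancels the linear terms `-K + cX/b` in the derivative of the logarithm,
  -- leaving a quadratic remainder.
  have hLd : ∀ r, 1 ≤ r → HasDerivAt
      (fun r => Real.log (w₁ r) + c / b * Real.log (w r) - 1 / b * K r)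
      ((K r ^ 2 - e * K r * w₁ r ^ 2 + c * (w₁ r ^ 2) ^ 2) / b / (w r * w₁ r)) r := by
    intro r hr
    have h1 := hw r hr
    have h2 := hw₁ r hr
    have h := ((((H.hasDerivAt_w₁ r (by linarith)).log h2.ne').fun_add
      (((H.hasDerivAt_w r (by linarith)).log h1.ne').const_mul (c / b))).fun_sub
      ((hKd r hr).const_mul (1 / b)))
    refine h.congr_deriv ?_
    have : w₂ r = -K r / w r := by rw [hK]; field_simp
    rw [this]
    field_simp
    ring
  clear hd hbd hγ
  obtain ⟨A₃, hA₃⟩ : ∃ A₃, A₃ = 1 / (1 - w₁ 1 ^ 2) := ⟨_, rfl⟩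
  obtain ⟨A₁, hA₁⟩ : ∃ A₁, A₁ = |e| * M / b + c / b + A₃ * (3 * M + b + |e|) + |e| := ⟨_, rfl⟩
  have hA₃0 : 0 < A₃ := by rw [hA₃]; exact one_div_pos.2 (sub_pos.2 hX1)
  have hA₁0 : 0 ≤ A₁ := by rw [hA₁]; positivity
  -- Each term of this Lyapunov function dissipates one quadratic quantity: `X` gives `KX`, `K²`
  -- gives `K²`, and `-KX` gives `X²`.
  have hΦd : ∀ r, 1 ≤ r → HasDerivAt (fun r => 1 / b *
      (A₁ * w₁ r ^ 2 + 1 / (2 * b) * K r ^ 2 - A₃ * (K r * w₁ r ^ 2)))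
      ((-(K r * w₁ r ^ 2 * (2 * A₁ - e * K r / b - c * (1 - w₁ r ^ 2) / b
        - A₃ * (3 * K r + b - e * w₁ r ^ 2)))
      - K r ^ 3 / b - K r ^ 2 - A₃ * (c * (w₁ r ^ 2) ^ 2 * (1 - w₁ r ^ 2))) / b
        / (w r * w₁ r)) r := by
    intro r hr
    have h1 := hw r hr
    have h2 := hw₁ r hr
    have h := ((((hXd r hr).const_mul A₁).fun_add (((hKd r hr).fun_pow 2).const_mul
      (1 / (2 * b)))).fun_sub (((hKd r hr).fun_mul (hXd r hr)).const_mul A₃)).const_mul (1 / b)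
    refine h.congr_deriv ?_
    field_simp
    ring
  have key := abs_le_of_abs_deriv_le hLd hΦd (P := 1 / b * (A₁ + 1 / (2 * b) * M ^ 2 + A₃ * M))
    (fun r hr => ?_) (fun r hr => ?_)
  · obtain ⟨L1, hL1⟩ : ∃ L1, L1 = |Real.log (w₁ 1) + c / b * Real.log (w 1) - 1 / b * K 1| :=
      ⟨_, rfl⟩
    rw [← hL1] at key
    refine ⟨L1 + 2 * (1 / b * (A₁ + 1 / (2 * b) * M ^ 2 + A₃ * M)) + 1 / b * M,
      fun r hr => ?_⟩
    have h1 := abs_le.1 (key r hr)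
    have h2 : 0 ≤ 1 / b * K r := mul_nonneg (by positivity) (hK0 r hr).le
    have h3 : 1 / b * K r ≤ 1 / b * M := mul_le_mul_of_nonneg_left (hKM r hr) (by positivity)
    rw [abs_le]
    constructor <;> linarith
  · rw [← neg_div, ← neg_div, abs_div, abs_div, abs_of_pos hb,
      abs_of_pos (mul_pos (hw r hr) (hw₁ r hr))]
    refine div_le_div_of_nonneg_right (div_le_div_of_nonneg_right ?_ hb.le)
      (mul_pos (hw r hr) (hw₁ r hr)).le
    exact lyapunov_inequality hc hb (hK0 r hr).le (hKM r hr) (sq_nonneg _) (hXX r hr) hX1 hA₃ hA₁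
  · have h1 := hK0 r hr
    have h2 := hKM r hr
    have h3 := (hXX r hr).trans hX1.le
    have h4 := sq_nonneg (w₁ r)
    rw [abs_mul, abs_of_pos (by positivity : 0 < 1 / b)]
    refine mul_le_mul_of_nonneg_left ?_ (by positivity)
    have s1 : A₁ * w₁ r ^ 2 ≤ A₁ * 1 := by gcongr
    have s2 : 1 / (2 * b) * K r ^ 2 ≤ 1 / (2 * b) * M ^ 2 := by gcongr
    have s3 : A₃ * (K r * w₁ r ^ 2) ≤ A₃ * (M * 1) := by gcongr
    have s4 : 0 ≤ A₁ * w₁ r ^ 2 := by positivity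
    have s5 : 0 ≤ 1 / (2 * b) * K r ^ 2 := by positivity
    have s6 : 0 ≤ A₃ * (K r * w₁ r ^ 2) := by positivity
    have s7 : 0 ≤ A₃ * M := by positivity
    have s8 : 0 ≤ 1 / (2 * b) * M ^ 2 := by positivity
    rw [abs_le]
    constructor <;> linarith

end SolitonODE

lemma TwoSidedO.abs_of_sign {φ v : ℝ → ℝ} {σ : ℝ} (hσ : |σ| = 1)
    (h : TwoSidedO (fun r => σ * φ r) v) (hv : ∀ᶠ r in atTop, 0 < v r) :
    TwoSidedO (fun r => |φ r|) v := by
  refine h.congr hv ?_ EventuallyEq.rfl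
  filter_upwards [h.eventually_pos hv] with r hr
  rw [← abs_of_pos hr, abs_mul, hσ, one_mul]

namespace SolitonODE

variable {m c : ℝ} {w w₁ w₂ φ φ₁ φ₂ : ℝ → ℝ} (H : SolitonODE m c w w₁ w₂ φ φ₁ φ₂)

include H

/-- Asymptotics of the warping factor and of the potential when `m ≠ 1`. -/
lemma asymptotics_of_ne_one (hm : m < 1 / 2 ∨ 1 < m) :
    TwoSidedO w (fun r => r ^ ((1 - m) / (2 - 3 * m))) ∧
    TwoSidedO (fun r => |φ r|) (fun r => r ^ ((2 - 4 * m) / (2 - 3 * m))) := by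
  have hc := H.one_le_c
  -- The sign `σ` treats both ranges of `m` at once; `σφ` turns out to be eventually positive.
  obtain ⟨σ, hσ, hσ1, hσ2⟩ : ∃ σ : ℝ, |σ| = 1 ∧ 0 < σ * (2 * m - 1) ∧ 0 < σ * (m - 1) := by
    rcases hm with h | h
    · exact ⟨-1, by simp, by linarith, by linarith⟩
    · exact ⟨1, by simp, by linarith, by linarith⟩
  have hm1 : 2 * m - 1 ≠ 0 := right_ne_zero_of_mul hσ1.ne'
  have hm2 : m - 1 ≠ 0 := right_ne_zero_of_mul hσ2.ne'
  have hm3 : 0 < σ * (3 * m - 2) := by linarith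
  have hm4 : 3 * m - 2 ≠ 0 := right_ne_zero_of_mul hm3.ne'
  have hm5 : 1 - m ≠ 0 := fun h => hm2 (by linarith)
  have hm6 : 2 - 3 * m ≠ 0 := fun h => hm4 (by linarith)
  have hσ0 : σ ≠ 0 := left_ne_zero_of_mul hσ1.ne'
  have hγ : 0 < (1 - 2 * m) / (1 - m) := by
    rw [show (1 - 2 * m) / (1 - m) = σ * (2 * m - 1) / (σ * (m - 1)) by
      rw [mul_div_mul_left _ _ hσ0, ← neg_div_neg_eq]; ring]
    positivity
  have hb : 0 < (1 - m) * c / (1 - 2 * m) := by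
    rw [mul_div_right_comm, ← inv_div]
    positivity
  have hβ : 0 < (2 - 4 * m) / (2 - 3 * m) := by
    rw [show (2 - 4 * m) / (2 - 3 * m) = 2 * (σ * (2 * m - 1)) / (σ * (3 * m - 2)) by
      rw [mul_left_comm, mul_div_mul_left _ _ hσ0, ← neg_div_neg_eq]; ring]
    positivity
  obtain ⟨B, hB⟩ := H.exists_abs_log_le hm1 (fun h => hm2 (by linarith)) hb
  obtain ⟨M, hM⟩ := H.exists_ww₂_le hm1 hb
  obtain ⟨γ, hγd⟩ : ∃ γ, γ = (1 - 2 * m) / (1 - m) := ⟨_, rfl⟩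
  rw [← hγd] at hγ hB
  have hα : (1 - m) / (2 - 3 * m) = 1 * (1 / (γ + 1)) := by
    rw [hγd, div_add_one hm5, one_mul, one_div_div]
    congr 1
    ring
  have hαβ : (2 - 4 * m) / (2 - 3 * m)
      = (1 - m) / (2 - 3 * m) * γ - (1 - m) / (2 - 3 * m) + 1 := by
    have h : (1 - m) / (2 - 3 * m) * ((1 - 2 * m) / (1 - m)) = (1 - 2 * m) / (2 - 3 * m) := by
      field_simp
    rw [hγd, h, ← sub_div, div_add_one hm6]
    congr 1
    ring
  have hu : TwoSidedO (fun r => w r ^ γ * w₁ r) (fun r => r ^ (0 : ℝ)) := by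
    refine TwoSidedO.of_eventually (Real.exp_pos (-B)) (Real.exp_pos B) (eventually_rpow_pos 0) ?_
    filter_upwards [eventually_ge_atTop 1] with r hr
    have hw := H.w_pos r (by linarith)
    have hw₁ := H.w₁_pos r (by linarith)
    have hp : 0 < w r ^ γ * w₁ r := mul_pos (Real.rpow_pos_of_pos hw γ) hw₁
    have h := abs_le.1 (hB r hr)
    have hl : Real.log (w r ^ γ * w₁ r) = Real.log (w₁ r) + γ * Real.log (w r) := by
      rw [Real.log_mul (Real.rpow_pos_of_pos hw γ).ne' hw₁.ne', Real.log_rpow hw, add_comm]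
    rw [← hl] at h
    rw [Real.rpow_zero, mul_one, mul_one, ← Real.le_log_iff_exp_le hp, ← Real.log_le_iff_le_exp hp]
    exact h
  -- The derivative is `(γ+1) w^γ w'`, bounded between positive constants, so integration gives
  -- linear growth.
  have hwγ : TwoSidedO (fun r => w r ^ (γ + 1)) (fun r => r ^ ((0 : ℝ) + 1)) := by
    refine TwoSidedO.of_hasDerivAt (by norm_num)
      (F' := fun r => (γ + 1) * (w r ^ γ * w₁ r)) (fun r hr => ?_) ?_
    · refine ((H.hasDerivAt_w r hr).rpow_const (p := γ + 1)
        (Or.inl (H.w_pos r hr).ne')).congr_deriv ?_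
      rw [add_sub_cancel_right]
      ring
    · obtain ⟨A', B', hA', hB', h⟩ := hu.eventually
      refine TwoSidedO.of_eventually (A := (γ + 1) * A') (B := (γ + 1) * B') (by positivity)
        (by positivity) (eventually_rpow_pos 0) ?_
      filter_upwards [h] with r hr
      rw [mul_assoc, mul_assoc]
      exact ⟨mul_le_mul_of_nonneg_left hr.1 (by positivity),
        mul_le_mul_of_nonneg_left hr.2 (by positivity)⟩
  have hw : TwoSidedO w (fun r => r ^ ((1 - m) / (2 - 3 * m))) := by
    refine (hwγ.rpow (eventually_rpow_pos _) (q := 1 / (γ + 1)) (by positivity)).congr ?_ ?_ ?_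
    · filter_upwards [eventually_gt_atTop 0] with r hr
      positivity
    · filter_upwards [eventually_gt_atTop 0] with r hr
      rw [← Real.rpow_mul (H.w_pos r hr).le, mul_one_div_cancel (by positivity), Real.rpow_one]
    · filter_upwards [eventually_gt_atTop 0] with r hr
      rw [← Real.rpow_mul hr.le, hα, zero_add]
  refine ⟨hw, TwoSidedO.abs_of_sign hσ ?_ (eventually_rpow_pos _)⟩
  rw [hαβ] at hβ ⊢
  refine TwoSidedO.of_hasDerivAt hβ (fun r hr => (H.hasDerivAt_φ r hr).const_mul σ) ?_
  -- By the spherical equation this is a sum of two nonnegative bounded terms; the one with `1 -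
  -- w'²` stays away from zero because `w'` decreases.
  have hQ : TwoSidedO (fun r => σ * (w r * w₁ r * φ₁ r)) (fun r => r ^ (0 : ℝ)) := by
    have hX1 : 0 < 1 - w₁ 1 ^ 2 := by nlinarith [H.w₁_pos 1 one_pos, H.w₁_lt_one 1 one_pos]
    have hM0 : 0 ≤ M := by
      have h1 := hM 1 le_rfl
      nlinarith [H.w_pos 1 one_pos, H.w₂_neg 1 one_pos]
    refine TwoSidedO.of_eventually (A := σ * (m - 1) * (c * (1 - w₁ 1 ^ 2)))
      (B := σ * (2 * m - 1) * M + σ * (m - 1) * (c * 1)) (by positivity) (by positivity)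
      (eventually_rpow_pos 0) ?_
    filter_upwards [eventually_ge_atTop 1] with r hr
    have hK0 : 0 ≤ -(w r * w₂ r) := by
      nlinarith [H.w₂_neg r (by linarith), H.w_pos r (by linarith)]
    have hX : w₁ r ^ 2 ≤ w₁ 1 ^ 2 := pow_le_pow_left₀ (H.w₁_pos r (by linarith)).le (H.w₁_le hr) 2
    have e : σ * (w r * w₁ r * φ₁ r) = σ * (2 * m - 1) * -(w r * w₂ r)
        + σ * (m - 1) * (c * (1 - w₁ r ^ 2)) := by
      rw [H.spherical_eq r (by linarith)]
      ring
    rw [e, Real.rpow_zero, mul_one, mul_one]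
    constructor
    · have : σ * (m - 1) * (c * (1 - w₁ 1 ^ 2)) ≤ σ * (m - 1) * (c * (1 - w₁ r ^ 2)) := by gcongr
      have := mul_nonneg hσ1.le hK0
      linarith
    · have h1 := hM r hr
      have h2 : 1 - w₁ r ^ 2 ≤ 1 := by linarith [sq_nonneg (w₁ r)]
      gcongr
  -- Uses `σφ' = σ(w w' φ') · w^γ / (w · w^γ w')`, each factor having known growth.
  have hall := (hQ.mul (hw.rpow (eventually_rpow_pos _) hγ.le) (eventually_rpow_pos _) ?_).mul
    ((hw.mul hu (eventually_rpow_pos _) (eventually_rpow_pos _)).inv ?_) ?_ ?_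
  · refine hall.congr ?_ ?_ ?_
    · filter_upwards [eventually_gt_atTop 0] with r hr
      positivity
    · filter_upwards [eventually_gt_atTop 0] with r hr
      have h1 := H.w_pos r hr
      have h2 := H.w₁_pos r hr
      have h3 := Real.rpow_pos_of_pos h1 γ
      field_simp
    · filter_upwards [eventually_gt_atTop 0] with r hr
      rw [← Real.rpow_mul hr.le, Real.rpow_zero, one_mul, mul_one, Real.rpow_sub hr]
      exact (div_eq_mul_inv _ _).symm
  all_goals
    filter_upwards [eventually_gt_atTop 0] with r hr
    positivity

end SolitonODE

/-! ### The cylindrical case `m = 1`. -/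

/-- Polynomial expressions in `φ'`, `w'` and `1 / w`. -/
inductive IsPolyExpr (w w₁ φ₁ : ℝ → ℝ) : (ℝ → ℝ) → Prop
  | const (a : ℝ) : IsPolyExpr w w₁ φ₁ fun _ => a
  | w₁ : IsPolyExpr w w₁ φ₁ w₁
  | φ₁ : IsPolyExpr w w₁ φ₁ φ₁
  | inv : IsPolyExpr w w₁ φ₁ fun r => (w r)⁻¹
  | add {F G : ℝ → ℝ} : IsPolyExpr w w₁ φ₁ F → IsPolyExpr w w₁ φ₁ G →
      IsPolyExpr w w₁ φ₁ fun r => F r + G r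
  | mul {F G : ℝ → ℝ} : IsPolyExpr w w₁ φ₁ F → IsPolyExpr w w₁ φ₁ G →
      IsPolyExpr w w₁ φ₁ fun r => F r * G r

namespace SolitonODE

variable {c : ℝ} {w w₁ w₂ φ φ₁ φ₂ : ℝ → ℝ} (H : SolitonODE 1 c w w₁ w₂ φ φ₁ φ₂)

include H

lemma w₂_eq {r : ℝ} (hr : 0 < r) : w₂ r = -(w₁ r * φ₁ r) := by
  have h := H.spherical_eq r hr
  have hw := H.w_pos r hr
  have : w r * (w₂ r + w₁ r * φ₁ r) = 0 := by linear_combination h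
  linarith [(mul_eq_zero.1 this).resolve_left hw.ne']

lemma φ₂_eq {r : ℝ} (hr : 0 < r) : φ₂ r = c * (1 - w₁ r ^ 2) * ((w r)⁻¹ * (w r)⁻¹)
    - (c - 1) * (w₁ r * φ₁ r) * (w r)⁻¹ := by
  have h := H.radial_eq r hr
  rw [H.w₂_eq hr] at h
  have hw := H.w_pos r hr
  field_simp
  linear_combination h

lemma φ₁_pos {r : ℝ} (hr : 0 < r) : 0 < φ₁ r := by
  have h := H.w₂_eq hr
  have h2 := H.w₂_neg r hr
  exact pos_of_mul_pos_right (by linarith : 0 < w₁ r * φ₁ r) (H.w₁_pos r hr).le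

/-- A barrier from below: at level `y₀`, `w (w φ')' = c(1 - w'²) - (c-2) w' y₀`, which is positive
because `y₀` is at most half of `1 - w'(1)²`. -/
lemma exists_le_wφ₁ : ∃ y₀, 0 < y₀ ∧ ∀ r, 1 ≤ r → y₀ ≤ w r * φ₁ r := by
  have hc := H.one_le_c
  have hX1 : 0 < 1 - w₁ 1 ^ 2 := by nlinarith [H.w₁_pos 1 one_pos, H.w₁_lt_one 1 one_pos]
  obtain ⟨y₀, hy₀⟩ : ∃ y₀, y₀ = min (w 1 * φ₁ 1) ((1 - w₁ 1 ^ 2) / 2) := ⟨_, rfl⟩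
  have hy1 : y₀ ≤ w 1 * φ₁ 1 := hy₀ ▸ min_le_left _ _
  have hy2 : y₀ ≤ (1 - w₁ 1 ^ 2) / 2 := hy₀ ▸ min_le_right _ _
  have hy : 0 < y₀ := by
    rw [hy₀]
    exact lt_min (mul_pos (H.w_pos 1 one_pos) (H.φ₁_pos one_pos)) (by linarith)
  refine ⟨y₀, hy, fun r hr => ?_⟩
  have hd : ∀ s, 1 ≤ s → HasDerivAt (fun r => -(w r * φ₁ r)) _ s := fun s hs =>
    ((H.hasDerivAt_w s (by linarith)).fun_mul (H.hasDerivAt_φ₁ s (by linarith))).fun_neg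
  have key := image_le_of_deriv_right_lt_deriv_boundary' (a := 1) (b := r) (B := fun _ => -y₀)
    (B' := fun _ => 0) (fun s hs => (hd s hs.1).continuousAt.continuousWithinAt)
    (fun s hs => (hd s hs.1).hasDerivWithinAt) (neg_le_neg hy1) continuousOn_const
    (fun s hs => hasDerivWithinAt_const _ _ _) (fun s hs hK => ?_) ⟨hr, le_rfl⟩
  · linarith
  have hs0 : 0 < s := by linarith [hs.1]
  have hw := H.w_pos s hs0
  have hw₁ := H.w₁_pos s hs0
  have hw₁' := H.w₁_lt_one s hs0
  have hX : w₁ s ^ 2 ≤ w₁ 1 ^ 2 := pow_le_pow_left₀ hw₁.le (H.w₁_le hs.1) 2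
  have hK' : w s * φ₁ s = y₀ := by linarith
  rw [neg_lt_zero]
  have e : w s * (w₁ s * φ₁ s + w s * φ₂ s) = c * (1 - w₁ s ^ 2) - (c - 2) * (w₁ s * y₀) := by
    rw [H.φ₂_eq hs0, ← hK']
    field_simp
    ring
  refine pos_of_mul_pos_right (a := w s) ?_ hw.le
  rw [e]
  have h1 : w₁ s * y₀ < 1 * y₀ := by gcongr
  have h2 : 0 ≤ w₁ s * y₀ := by positivity
  have h3 : (c - 2) * (w₁ s * y₀) ≤ c * y₀ := by nlinarith
  have h4 : c * y₀ ≤ c * ((1 - w₁ 1 ^ 2) / 2) := by gcongr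
  have h5 : c * (1 - w₁ 1 ^ 2) ≤ c * (1 - w₁ s ^ 2) := by gcongr
  have h6 : 0 < c * (1 - w₁ 1 ^ 2) := by positivity
  linarith

lemma w_mono {r s : ℝ} (hr : 1 ≤ r) (hs : r ≤ s) : w r ≤ w s := by
  have := antitoneOn_Ici_of_hasDerivAt_nonpos (a := 1)
    (fun r hr => (H.hasDerivAt_w r (by linarith)).fun_neg)
    (fun r hr => neg_nonpos.2 (H.w₁_pos r (by linarith)).le) hr (hr.trans hs : (1 : ℝ) ≤ s) hs
  simp only at this
  linarith

/-- Since `w'' = -w' φ' ≤ -y₀ w'/w`, the quantity `w' + y₀ log w` is nonincreasing, and `w' > 0`. -/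
lemma exists_w_le : ∃ M, ∀ r, 1 ≤ r → w r ≤ M := by
  obtain ⟨y₀, hy, h⟩ := H.exists_le_wφ₁
  refine ⟨Real.exp ((w₁ 1 + y₀ * Real.log (w 1)) / y₀), fun r hr => ?_⟩
  have hw := H.w_pos r (by linarith)
  have key := antitoneOn_Ici_of_hasDerivAt_nonpos (a := 1)
    (fun r hr => (H.hasDerivAt_w₁ r (by linarith)).fun_add
      (((H.hasDerivAt_w r (by linarith)).log (H.w_pos r (by linarith)).ne').const_mul y₀))
    (fun r hr => by
      have hw := H.w_pos r (by linarith)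
      have hw₁ := H.w₁_pos r (by linarith)
      rw [H.w₂_eq (by linarith)]
      have h1 := mul_le_mul_of_nonneg_left (h r hr) hw₁.le
      field_simp
      linarith) Set.self_mem_Ici hr hr
  simp only at key
  rw [← Real.log_le_iff_le_exp hw, le_div_iff₀ hy]
  linarith [H.w₁_pos r (by linarith)]

/-- The logarithmic derivative of `w'` is `-φ'`, and `φ' ≥ y₀/w ≥ y₀/M`. -/
lemma exists_w₁_le_exp : ∃ C κ, 0 < κ ∧ ∀ r, 1 ≤ r → w₁ r ≤ C * Real.exp (-κ * r) := by
  obtain ⟨y₀, hy, h⟩ := H.exists_le_wφ₁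
  obtain ⟨M, hM⟩ := H.exists_w_le
  have hM0 : 0 < M := (H.w_pos 1 one_pos).trans_le (hM 1 le_rfl)
  refine ⟨Real.exp (Real.log (w₁ 1) + y₀ / M * 1), y₀ / M, by positivity, fun r hr => ?_⟩
  have key := antitoneOn_Ici_of_hasDerivAt_nonpos (a := 1)
    (fun r hr => ((H.hasDerivAt_w₁ r (by linarith)).log (H.w₁_pos r (by linarith)).ne').fun_add
      ((hasDerivAt_id' r).const_mul (y₀ / M)))
    (fun r hr => by
      have hw := H.w_pos r (by linarith)
      have hw₁ := H.w₁_pos r (by linarith)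
      have hφ := H.φ₁_pos (r := r) (by linarith)
      rw [H.w₂_eq (by linarith), neg_div, mul_div_cancel_left₀ _ hw₁.ne', mul_one]
      have h1 : w r * φ₁ r ≤ M * φ₁ r := by gcongr; exact hM r hr
      have h2 : y₀ / M ≤ φ₁ r := by
        rw [div_le_iff₀ hM0]
        linarith [h r hr]
      linarith) Set.self_mem_Ici hr hr
  simp only at key
  rw [← Real.exp_add, ← Real.log_le_iff_le_exp (H.w₁_pos r (by linarith))]
  linarith

lemma exists_w_tendsto : ∃ a, 0 < a ∧ Tendsto w atTop (𝓝 a) := by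
  obtain ⟨M, hM⟩ := H.exists_w_le
  have hmono : Monotone fun r => w (max r 1) := fun r s hrs =>
    H.w_mono (le_max_right _ _) (max_le_max_right 1 hrs)
  have hb : BddAbove (Set.range fun r => w (max r 1)) :=
    ⟨M, by rintro _ ⟨r, rfl⟩; exact hM _ (le_max_right _ _)⟩
  have ht := tendsto_atTop_ciSup hmono hb
  refine ⟨_, ?_, ht.congr' ?_⟩
  · have := le_ciSup hb 1
    simp only [max_self] at this
    exact (H.w_pos 1 one_pos).trans_le this
  · filter_upwards [eventually_ge_atTop 1] with r hr
    rw [max_eq_left hr]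

/-- Dropping the nonpositive term from `φ''` leaves at most `c/w²`, which is at most `c/w(1)²` since
`w` increases. -/
lemma exists_φ₁_le : ∃ C, 0 ≤ C ∧ ∀ r, 1 ≤ r → φ₁ r ≤ C * r := by
  have hc := H.one_le_c
  have hw1 := H.w_pos 1 one_pos
  have hp := H.φ₁_pos one_pos
  have h0 : 0 ≤ c * ((w 1)⁻¹ * (w 1)⁻¹) := by positivity
  refine ⟨c * ((w 1)⁻¹ * (w 1)⁻¹) + φ₁ 1, by positivity, fun r hr => ?_⟩
  have key := antitoneOn_Ici_of_hasDerivAt_nonpos (a := 1)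
    (fun r hr => (H.hasDerivAt_φ₁ r (by linarith)).fun_sub
      ((hasDerivAt_id' r).const_mul (c * ((w 1)⁻¹ * (w 1)⁻¹))))
    (fun r hr => by
      have hw := H.w_pos r (by linarith)
      have hw₁ := H.w₁_pos r (by linarith)
      have hw₁' := H.w₁_lt_one r (by linarith)
      have hφ := H.φ₁_pos (r := r) (by linarith)
      rw [H.φ₂_eq (by linarith)]
      have h1 : (w r)⁻¹ ≤ (w 1)⁻¹ := inv_anti₀ hw1 (H.w_mono le_rfl hr)
      have h2 : 0 ≤ (c - 1) * (w₁ r * φ₁ r) * (w r)⁻¹ :=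
        mul_nonneg (mul_nonneg (by linarith) (by positivity)) (by positivity)
      have h3 : c * (1 - w₁ r ^ 2) * ((w r)⁻¹ * (w r)⁻¹) ≤ c * 1 * ((w 1)⁻¹ * (w 1)⁻¹) := by
        gcongr
        linarith [sq_nonneg (w₁ r)]
      linarith) Set.self_mem_Ici hr hr
  simp only at key
  nlinarith

lemma isPolyExpr_isBigO {F : ℝ → ℝ} (hF : IsPolyExpr w w₁ φ₁ F) :
    ∃ j : ℕ, F =O[atTop] fun r : ℝ => r ^ j := by
  have hle : ∀ {a b : ℕ}, a ≤ b → (fun r : ℝ => r ^ a) =O[atTop] fun r : ℝ => r ^ b := by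
    intro a b hab
    refine Asymptotics.IsBigO.of_bound 1 ?_
    filter_upwards [eventually_ge_atTop 1] with r hr
    rw [norm_pow, norm_pow, one_mul]
    exact pow_le_pow_right₀ (hr.trans (le_abs_self r)) hab
  induction hF with
  | const a =>
    refine ⟨0, ?_⟩
    simpa using Asymptotics.isBigO_const_const a (one_ne_zero : (1 : ℝ) ≠ 0) (atTop : Filter ℝ)
  | w₁ =>
    refine ⟨0, Asymptotics.IsBigO.of_bound 1 ?_⟩
    filter_upwards [eventually_ge_atTop 1] with r hr
    rw [Real.norm_eq_abs, abs_of_pos (H.w₁_pos r (by linarith))]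
    simpa using (H.w₁_lt_one r (by linarith)).le
  | φ₁ =>
    obtain ⟨C, hC, h⟩ := H.exists_φ₁_le
    refine ⟨1, Asymptotics.IsBigO.of_bound C ?_⟩
    filter_upwards [eventually_ge_atTop 1] with r hr
    rw [Real.norm_eq_abs, abs_of_pos (H.φ₁_pos (by linarith)), pow_one, Real.norm_eq_abs,
      abs_of_nonneg (by linarith)]
    exact h r hr
  | inv =>
    refine ⟨0, Asymptotics.IsBigO.of_bound (w 1)⁻¹ ?_⟩
    filter_upwards [eventually_ge_atTop 1] with r hr
    rw [Real.norm_eq_abs, abs_of_pos (inv_pos.2 (H.w_pos r (by linarith)))]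
    simpa using inv_anti₀ (H.w_pos 1 one_pos) (H.w_mono le_rfl hr)
  | add _ _ ihF ihG =>
    obtain ⟨j, hj⟩ := ihF
    obtain ⟨k, hk⟩ := ihG
    exact ⟨max j k, (hj.trans (hle (le_max_left j k))).add (hk.trans (hle (le_max_right j k)))⟩
  | mul _ _ ihF ihG =>
    obtain ⟨j, hj⟩ := ihF
    obtain ⟨k, hk⟩ := ihG
    exact ⟨j + k, by simpa only [pow_add] using hj.mul hk⟩

lemma tendsto_w₁_mul {F : ℝ → ℝ} (hF : IsPolyExpr w w₁ φ₁ F) :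
    Tendsto (fun r => w₁ r * F r) atTop (𝓝 0) := by
  obtain ⟨j, hj⟩ := H.isPolyExpr_isBigO hF
  obtain ⟨C, κ, hκ, h⟩ := H.exists_w₁_le_exp
  have h1 : w₁ =O[atTop] fun r => Real.exp (-κ * r) := by
    refine Asymptotics.IsBigO.of_bound C ?_
    filter_upwards [eventually_ge_atTop 1] with r hr
    rw [Real.norm_eq_abs, abs_of_pos (H.w₁_pos r (by linarith)), Real.norm_eq_abs, Real.abs_exp]
    exact h r hr
  refine (h1.mul hj).trans_tendsto ?_
  have := tendsto_rpow_mul_exp_neg_mul_atTop_nhds_zero j κ hκ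
  refine this.congr fun r => ?_
  rw [Real.rpow_natCast, mul_comm]

/-- The equations for `w''` and `φ''` close this algebra under differentiation, so each derivative
of `w` keeps the exponentially small factor `w'`. -/
lemma exists_hasDerivAt_isPolyExpr {F : ℝ → ℝ} (hF : IsPolyExpr w w₁ φ₁ F) :
    ∃ F', IsPolyExpr w w₁ φ₁ F' ∧ ∀ r, 0 < r → HasDerivAt F (F' r) r := by
  induction hF with
  | const a => exact ⟨_, .const 0, fun r _ => hasDerivAt_const r a⟩
  | w₁ =>
    refine ⟨_, .mul (.const (-1)) (.mul .w₁ .φ₁), fun r hr => ?_⟩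
    refine (H.hasDerivAt_w₁ r hr).congr_deriv ?_
    rw [H.w₂_eq hr]
    ring
  | φ₁ =>
    refine ⟨_, .add (.mul (.mul (.const c) (.add (.const 1) (.mul (.const (-1)) (.mul .w₁ .w₁))))
      (.mul .inv .inv)) (.mul (.mul (.const (-(c - 1))) (.mul .w₁ .φ₁)) .inv), fun r hr => ?_⟩
    refine (H.hasDerivAt_φ₁ r hr).congr_deriv ?_
    rw [H.φ₂_eq hr]
    ring
  | inv =>
    refine ⟨_, .mul (.const (-1)) (.mul .w₁ (.mul .inv .inv)), fun r hr => ?_⟩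
    have hw := H.w_pos r hr
    refine ((H.hasDerivAt_w r hr).fun_inv hw.ne').congr_deriv ?_
    field_simp
  | add _ _ ihF ihG =>
    obtain ⟨F', hF', dF⟩ := ihF
    obtain ⟨G', hG', dG⟩ := ihG
    exact ⟨_, .add hF' hG', fun r hr => (dF r hr).fun_add (dG r hr)⟩
  | mul hF hG ihF ihG =>
    obtain ⟨F', hF', dF⟩ := ihF
    obtain ⟨G', hG', dG⟩ := ihG
    exact ⟨_, .add (.mul hF' hG) (.mul hF hG'), fun r hr => (dF r hr).fun_mul (dG r hr)⟩

lemma exists_iteratedDeriv_eq (k : ℕ) : ∃ F, IsPolyExpr w w₁ φ₁ F ∧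
    ∀ r, 0 < r → iteratedDeriv (k + 1) w r = w₁ r * F r := by
  induction k with
  | zero =>
    refine ⟨_, .const 1, fun r hr => ?_⟩
    rw [zero_add, iteratedDeriv_one, (H.hasDerivAt_w r hr).deriv, mul_one]
  | succ k ih =>
    obtain ⟨F, hF, h⟩ := ih
    obtain ⟨F', hF', dF⟩ := H.exists_hasDerivAt_isPolyExpr hF
    refine ⟨_, .add (.mul (.mul (.const (-1)) .φ₁) hF) hF', fun r hr => ?_⟩
    have he : iteratedDeriv (k + 1) w =ᶠ[𝓝 r] fun r => w₁ r * F r := by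
      filter_upwards [Ioi_mem_nhds hr] with s hs using h s hs
    rw [iteratedDeriv_succ, he.deriv_eq, ((H.hasDerivAt_w₁ r hr).fun_mul (dF r hr)).deriv,
      H.w₂_eq hr]
    ring

lemma isAsymptoticallyCylindrical : IsAsymptoticallyCylindrical w := by
  obtain ⟨a, ha, ht⟩ := H.exists_w_tendsto
  refine ⟨a, ha, ht, fun k hk => ?_⟩
  obtain ⟨k, rfl⟩ := Nat.exists_eq_add_of_le' hk
  obtain ⟨F, hF, h⟩ := H.exists_iteratedDeriv_eq k
  refine (H.tendsto_w₁_mul hF).congr' ?_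
  filter_upwards [eventually_gt_atTop 0] with r hr using (h r hr).symm

/-- Asymptotics of the warping factor and of the potential when `m = 1`. -/
lemma asymptotics_of_eq_one : TwoSidedO w (fun r => r ^ (0 : ℝ)) ∧
    TwoSidedO (fun r => |φ r|) (fun r => r ^ (2 : ℝ)) := by
  have hc := H.one_le_c
  obtain ⟨a, ha, ht⟩ := H.exists_w_tendsto
  -- The limit is `c/a² > 0`; two integrations give quadratic growth of `φ`.
  have hlim : Tendsto φ₂ atTop (𝓝 (c * (1 - 0 ^ 2) * (a⁻¹ * a⁻¹) - (c - 1) * 0 * a⁻¹)) := by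
    have h1 : Tendsto w₁ atTop (𝓝 0) := by
      simpa using H.tendsto_w₁_mul (.const 1)
    have h2 := H.tendsto_w₁_mul .φ₁
    have h3 := ht.inv₀ ha.ne'
    refine ((((h1.pow 2).const_sub 1).const_mul c).mul (h3.mul h3) |>.sub
      ((h2.const_mul (c - 1)).mul h3)).congr' ?_
    filter_upwards [eventually_gt_atTop 0] with r hr using (H.φ₂_eq hr).symm
  have tsO : ∀ {u : ℝ → ℝ} {l : ℝ}, 0 < l → Tendsto u atTop (𝓝 l) →
      TwoSidedO u (fun r => r ^ (0 : ℝ)) := by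
    intro u l hl hu
    refine TwoSidedO.of_eventually (A := l / 2) (B := 2 * l) (by positivity) (by positivity)
      (eventually_rpow_pos 0) ?_
    filter_upwards [hu.eventually (lt_mem_nhds (show l / 2 < l by linarith)),
      hu.eventually (gt_mem_nhds (show l < 2 * l by linarith))] with r h1 h2
    rw [Real.rpow_zero, mul_one, mul_one]
    exact ⟨h1.le, h2.le⟩
  refine ⟨tsO ha ht, ?_⟩
  have h1 := (tsO (by simp; positivity) hlim).of_hasDerivAt (by norm_num) H.hasDerivAt_φ₁
  have h2 := h1.of_hasDerivAt (by norm_num) H.hasDerivAt_φ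
  refine TwoSidedO.abs_of_sign (σ := 1) (by simp) ?_ (eventually_rpow_pos _)
  norm_num at h2 ⊢
  exact h2

end SolitonODE

/-! ### Geodesic balls and their volume. -/

namespace RMetric

variable {n : ℕ}

lemma continuous_coeff (g : RMetric n) (i j : Fin n) : Continuous fun x => g.coeff x i j :=
  (g.smooth i j).continuous

namespace IsRotationallySymmetric

variable {g : RMetric n} {w : ℝ → ℝ} (hs : g.IsRotationallySymmetric w)

include hs

/-- The metric is a multiple of a rank-one perturbation of the identity, so the matrix determinant
lemma applies. -/
lemma det_coeff {x : RSpace n} (hx : x ≠ 0) (hn : 1 ≤ n) :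
    √(g.coeff x).det = (w ‖x‖ / ‖x‖) ^ (n - 1) := by
  have hr : 0 < ‖x‖ := norm_pos_iff.2 hx
  have hw := hs.2.1 _ hr
  have h : g.coeff x = (w ‖x‖ / ‖x‖) ^ 2 • (1 + Matrix.replicateCol Unit
      (((1 - w ‖x‖ ^ 2 / ‖x‖ ^ 2) / w ‖x‖ ^ 2) • x.ofLp) * Matrix.replicateRow Unit x.ofLp) := by
    ext i j
    rw [hs.coeff_eq hx]
    simp only [Matrix.smul_apply, Matrix.add_apply, Matrix.mul_apply, Matrix.replicateCol_apply,
      Matrix.replicateRow_apply, Matrix.one_apply, Pi.smul_apply, smul_eq_mul, Finset.univ_unique,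
      Finset.sum_singleton, kd]
    field_simp
  have hd : x.ofLp ⬝ᵥ (((1 - w ‖x‖ ^ 2 / ‖x‖ ^ 2) / w ‖x‖ ^ 2) • x.ofLp)
      = (1 - w ‖x‖ ^ 2 / ‖x‖ ^ 2) / w ‖x‖ ^ 2 * ‖x‖ ^ 2 := by
    rw [dotProduct_smul, smul_eq_mul, ← sum_coord_mul_self]
    rfl
  rw [h, Matrix.det_smul, Matrix.det_one_add_replicateCol_mul_replicateRow, hd, Fintype.card_fin]
  have e : ((w ‖x‖ / ‖x‖) ^ 2) ^ n * (1 + (1 - w ‖x‖ ^ 2 / ‖x‖ ^ 2) / w ‖x‖ ^ 2 * ‖x‖ ^ 2)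
      = ((w ‖x‖ / ‖x‖) ^ (n - 1)) ^ 2 := by
    obtain ⟨k, rfl⟩ := Nat.exists_eq_add_of_le' hn
    rw [Nat.add_sub_cancel, pow_succ, ← pow_mul, ← pow_mul, mul_comm 2 k]
    field_simp
    ring
  rw [e, Real.sqrt_sq (by positivity)]

lemma sq_le_ip {x : RSpace n} (hx : x ≠ 0) (u : RSpace n) :
    (inner ℝ x u / ‖x‖) ^ 2 ≤ g.ip x u u := by
  have hr : 0 < ‖x‖ := norm_pos_iff.2 hx
  have hcs : (inner ℝ x u / ‖x‖) ^ 2 ≤ ‖u‖ ^ 2 := by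
    rw [sq_le_sq, abs_div, abs_norm, abs_norm, div_le_iff₀ hr, mul_comm]
    exact abs_real_inner_le_norm x u
  have e : g.ip x u u = (inner ℝ x u / ‖x‖) ^ 2
      + (w ‖x‖ / ‖x‖) ^ 2 * (‖u‖ ^ 2 - (inner ℝ x u / ‖x‖) ^ 2) := by
    rw [hs.ip_eq hx, real_inner_self_eq_norm_sq]
    field_simp
    ring
  rw [e]
  exact le_add_of_nonneg_right (mul_nonneg (sq_nonneg _) (sub_nonneg.2 hcs))

/-- Speed dominates the radial velocity. As the norm is not differentiable at the origin, which the
curve may revisit, `√(‖γ‖² + ε²)` is integrated instead. -/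
lemma norm_le_curveLength {γ : ℝ → RSpace n} (hγ : ContDiff ℝ 1 γ) (h0 : γ 0 = 0) :
    ‖γ 1‖ ≤ g.curveLength γ := by
  have hc : Continuous fun t => √(g.ip (γ t) (deriv γ t) (deriv γ t)) := by
    have h1 := hγ.continuous
    have h2 : Continuous (deriv γ) := hγ.continuous_deriv le_rfl
    refine Real.continuous_sqrt.comp ?_
    simp only [ip]
    refine continuous_finsetSum _ fun i _ => continuous_finsetSum _ fun j _ => ?_
    have h3 : ∀ i, Continuous fun t => deriv γ t i := fun i =>
      (EuclideanSpace.proj (𝕜 := ℝ) i).continuous.comp h2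
    exact (((g.continuous_coeff i j).comp h1).mul (h3 i)).mul (h3 j)
  refine le_of_forall_pos_le_add fun ε hε => ?_
  have hpos : ∀ t, 0 < ‖γ t‖ ^ 2 + ε ^ 2 := fun t => by positivity
  have hd : ∀ t, HasDerivAt (fun t => √(‖γ t‖ ^ 2 + ε ^ 2))
      (inner ℝ (γ t) (deriv γ t) / √(‖γ t‖ ^ 2 + ε ^ 2)) t := by
    intro t
    have h := ((((hγ.differentiable one_ne_zero t).hasDerivAt).norm_sq).add_const (ε ^ 2)).sqrt
      (hpos t).ne'
    refine h.congr_deriv ?_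
    rw [mul_div_mul_left _ _ two_ne_zero]
  have hcd : Continuous fun t => inner ℝ (γ t) (deriv γ t) / √(‖γ t‖ ^ 2 + ε ^ 2) := by
    refine (hγ.continuous.inner (hγ.continuous_deriv le_rfl)).div
      (Real.continuous_sqrt.comp (by have := hγ.continuous; fun_prop)) fun t =>
        (Real.sqrt_pos.2 (hpos t)).ne'
  have hint := intervalIntegral.integral_eq_sub_of_hasDerivAt (a := 0) (b := 1)
    (fun t _ => hd t) (hcd.intervalIntegrable _ _)
  have hmono : ∫ t in (0 : ℝ)..1, inner ℝ (γ t) (deriv γ t) / √(‖γ t‖ ^ 2 + ε ^ 2)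
      ≤ g.curveLength γ := by
    refine intervalIntegral.integral_mono zero_le_one (hcd.intervalIntegrable _ _)
      (hc.intervalIntegrable _ _) fun t => ?_
    by_cases hγt : γ t = 0
    · simp only [hγt, inner_zero_left, zero_div]
      exact Real.sqrt_nonneg _
    · have hn := norm_pos_iff.2 hγt
      calc inner ℝ (γ t) (deriv γ t) / √(‖γ t‖ ^ 2 + ε ^ 2)
          ≤ |inner ℝ (γ t) (deriv γ t)| / √(‖γ t‖ ^ 2 + ε ^ 2) := by
            gcongr
            exact le_abs_self _
        _ ≤ |inner ℝ (γ t) (deriv γ t)| / ‖γ t‖ := by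
            gcongr
            exact Real.le_sqrt_of_sq_le (by linarith [sq_nonneg ε])
        _ = |inner ℝ (γ t) (deriv γ t) / ‖γ t‖| := by rw [abs_div, abs_norm]
        _ ≤ _ := Real.abs_le_sqrt (hs.sq_le_ip hγt _)
  rw [hint, h0, norm_zero, zero_pow two_ne_zero, zero_add, Real.sqrt_sq hε.le] at hmono
  have : ‖γ 1‖ ≤ √(‖γ 1‖ ^ 2 + ε ^ 2) := Real.le_sqrt_of_sq_le (by linarith [sq_nonneg ε])
  linarith

/-- The Riemannian distance to the origin is the Euclidean one. -/
lemma rdist_zero_eq (x : RSpace n) : g.rdist 0 x = ‖x‖ := by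
  refine IsLeast.csInf_eq ⟨⟨fun t => t • x, by fun_prop, by simp, by simp, ?_⟩, ?_⟩
  · have hd : ∀ t : ℝ, deriv (fun t : ℝ => t • x) t = x := fun t => by
      simpa using ((hasDerivAt_id t).smul_const x).deriv
    have h : g.curveLength (fun t => t • x) = ∫ t in (0 : ℝ)..1, ‖x‖ := by
      rw [curveLength]
      refine intervalIntegral.integral_congr_ae (Eventually.of_forall fun t ht => ?_)
      -- The half-open interval excludes `t = 0`, where the radial normal form is unavailable.
      rw [Set.uIoc_of_le zero_le_one] at ht
      rw [hd, ← Real.sqrt_sq (norm_nonneg x)]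
      congr 1
      by_cases hx : x = 0
      · simp [hx, ip]
      · have hr : 0 < ‖x‖ := norm_pos_iff.2 hx
        have ht0 := ht.1
        rw [hs.ip_eq (smul_ne_zero ht0.ne' hx), inner_smul_left, real_inner_self_eq_norm_sq,
          norm_smul, Real.norm_eq_abs, abs_of_pos ht0]
        simp only [RCLike.conj_to_real]
        field_simp
        ring
    rw [h]
    simp
  · rintro L ⟨γ, hγ, h0, h1, rfl⟩
    rw [← h1]
    exact hs.norm_le_curveLength hγ h0

lemma rball_zero_eq (r : ℝ) : g.rball 0 r = Metric.ball 0 r := by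
  ext x
  rw [rball, Set.mem_ofPred_eq, hs.rdist_zero_eq, mem_ball_zero_iff]

/-- Nothing is prescribed about `w` at and below `0`. Reading it off a smooth tangential metric
coefficient along an axis gives a function continuous on the whole line, as needed to differentiate
the volume integral. -/
lemma exists_continuous_extension (hn : 2 ≤ n) :
    ∃ W : ℝ → ℝ, Continuous W ∧ ∀ r, 0 < r → W r = w r := by
  let i : Fin n := ⟨0, by omega⟩
  let j : Fin n := ⟨1, by omega⟩
  have hij : i ≠ j := by simp [i, j]
  refine ⟨fun r => r * √(g.coeff (r • EuclideanSpace.single i 1) j j), ?_, fun r hr => ?_⟩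
  · exact continuous_id.mul (Real.continuous_sqrt.comp
      ((g.continuous_coeff j j).comp (continuous_id.smul continuous_const)))
  · have hx : r • (EuclideanSpace.single i 1 : RSpace n) ≠ 0 := by simp [hr.ne']
    have hnorm : ‖r • (EuclideanSpace.single i 1 : RSpace n)‖ = r := by
      simp [norm_smul, abs_of_pos hr]
    have hw := hs.2.1 r hr
    beta_reduce
    rw [hs.coeff_eq hx, hnorm, kd_self]
    simp only [PiLp.smul_apply, PiLp.single_apply, hij.symm, if_false, smul_zero, mul_zero,
      add_zero, mul_one]
    rw [← div_pow, Real.sqrt_sq (by positivity)]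
    field_simp

lemma vol_rball_toReal (hn : 2 ≤ n) {W : ℝ → ℝ} (hW : ∀ r, 0 < r → W r = w r) {r : ℝ}
    (hr : 0 < r) : (g.vol (g.rball 0 r)).toReal
      = (n : ℝ) * (volume : Measure (RSpace n)).real (Metric.ball 0 1)
        * ∫ s in (0 : ℝ)..r, W s ^ (n - 1) := by
  have : Nontrivial (RSpace n) := by
    have : Nonempty (Fin n) := ⟨⟨0, by omega⟩⟩
    infer_instance
  have hdet : Continuous fun x => √(g.coeff x).det :=
    Real.continuous_sqrt.comp
      ((continuous_matrix fun i j => g.continuous_coeff i j).matrix_det)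
  rw [hs.rball_zero_eq, vol, withDensity_apply _ measurableSet_ball,
    ← integral_eq_lintegral_of_nonneg_ae (Eventually.of_forall fun x => Real.sqrt_nonneg _)
      hdet.aestronglyMeasurable, ← integral_indicator measurableSet_ball]
  have h1 : ∫ x, (Metric.ball (0 : RSpace n) r).indicator (fun x => √(g.coeff x).det) x
      = ∫ x : RSpace n, (Set.Iio r).indicator (fun s => (w s / s) ^ (n - 1)) ‖x‖ := by
    refine integral_congr_ae ?_
    have h0 : ∀ᵐ x : RSpace n, x ≠ 0 := by
      rw [ae_iff]
      simp
    filter_upwards [h0] with x hx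
    by_cases hxr : ‖x‖ < r
    · rw [Set.indicator_of_mem (mem_ball_zero_iff.2 hxr), Set.indicator_of_mem (Set.mem_Iio.2 hxr),
        hs.det_coeff hx (by omega)]
    · rw [Set.indicator_of_notMem (by simpa using hxr), Set.indicator_of_notMem (by simpa using hxr)]
  rw [h1, integral_fun_norm_addHaar, finrank_euclideanSpace_fin, nsmul_eq_mul, smul_eq_mul,
    ← mul_assoc, intervalIntegral.integral_of_le hr.le, integral_Ioc_eq_integral_Ioo]
  congr 1
  rw [← integral_indicator measurableSet_Ioo, ← integral_indicator measurableSet_Ioi]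
  congr 1
  funext s
  by_cases h0 : 0 < s
  · by_cases hsr : s < r
    · rw [Set.indicator_of_mem (Set.mem_Ioi.2 h0), Set.indicator_of_mem (Set.mem_Iio.2 hsr),
        Set.indicator_of_mem (Set.mem_Ioo.2 ⟨h0, hsr⟩), hW s h0, smul_eq_mul, ← mul_pow,
        mul_div_cancel₀ _ h0.ne']
    · rw [Set.indicator_of_mem (Set.mem_Ioi.2 h0), Set.indicator_of_notMem (by simpa using hsr),
        Set.indicator_of_notMem (fun h => hsr h.2), smul_zero]
  · rw [Set.indicator_of_notMem (by simpa using h0), Set.indicator_of_notMem (fun h => h0 h.1)]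

/-- Volume growth of the balls about the origin, from the growth of the warping factor. -/
lemma twoSidedO_vol (hn : 2 ≤ n) {α : ℝ} (hα : 0 < ((n : ℝ) - 1) * α + 1)
    (hw : TwoSidedO w (fun r => r ^ α)) :
    TwoSidedO (fun r => (g.vol (g.rball 0 r)).toReal)
      (fun r => r ^ (((n : ℝ) - 1) * α + 1)) := by
  obtain ⟨W, hWc, hW⟩ := hs.exists_continuous_extension hn
  have : Nontrivial (RSpace n) := by
    have : Nonempty (Fin n) := ⟨⟨0, by omega⟩⟩
    infer_instance
  obtain ⟨κ, hκ⟩ : ∃ κ, κ = (n : ℝ) * (volume : Measure (RSpace n)).real (Metric.ball 0 1) :=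
    ⟨_, rfl⟩
  have hκ0 : 0 < κ := by
    rw [hκ]
    refine mul_pos (by exact_mod_cast (by omega : 0 < n)) ?_
    exact ENNReal.toReal_pos (Metric.measure_ball_pos _ _ one_pos).ne' measure_ball_lt_top.ne
  have hcast : ((n - 1 : ℕ) : ℝ) = (n : ℝ) - 1 := by
    rw [Nat.cast_sub (by omega), Nat.cast_one]
  have h1 : TwoSidedO (fun r => κ * W r ^ (n - 1)) (fun r => r ^ (((n : ℝ) - 1) * α)) := by
    obtain ⟨A, B, hA, hB, h⟩ := (hw.rpow (eventually_rpow_pos α)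
      (q := (n : ℝ) - 1) (by rw [← hcast]; positivity)).eventually
    refine TwoSidedO.of_eventually (mul_pos hκ0 hA) (mul_pos hκ0 hB) (eventually_rpow_pos _) ?_
    filter_upwards [h, eventually_gt_atTop 0] with r h2 hr
    rw [← Real.rpow_mul hr.le, mul_comm α] at h2
    rw [hW r hr, ← Real.rpow_natCast, hcast, mul_assoc, mul_assoc]
    exact ⟨mul_le_mul_of_nonneg_left h2.1 hκ0.le, mul_le_mul_of_nonneg_left h2.2 hκ0.le⟩
  have h2 := TwoSidedO.of_hasDerivAt hα (F := fun r => κ * ∫ s in (0 : ℝ)..r, W s ^ (n - 1))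
    (fun r _ => ((intervalIntegral.integral_hasDerivAt_right
      ((hWc.pow _).intervalIntegrable _ _) ((hWc.pow _).stronglyMeasurableAtFilter _ _)
      (hWc.pow _).continuousAt).const_mul κ)) h1
  refine h2.congr (eventually_rpow_pos _) ?_ EventuallyEq.rfl
  filter_upwards [eventually_gt_atTop 0] with r hr
  rw [hs.vol_rball_toReal hn hW hr, hκ]

end IsRotationallySymmetric

end RMetric

/-! ### From the geometry to the ODE system, and the conclusion. -/

lemma pos_of_hasDerivAt_of_neg_deriv {w w₁ w₂ : ℝ → ℝ}
    (h1 : ∀ r, 0 < r → HasDerivAt w (w₁ r) r) (h2 : ∀ r, 0 < r → HasDerivAt w₁ (w₂ r) r)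
    (hw : ∀ r, 0 < r → 0 < w r) (hw₂ : ∀ r, 0 < r → w₂ r < 0) {r : ℝ} (hr : 0 < r) :
    0 < w₁ r := by
  have hanti : StrictAntiOn w₁ (Set.Ici r) := by
    refine strictAntiOn_of_deriv_neg (convex_Ici r)
      (fun s hs => (h2 s (hr.trans_le hs)).continuousAt.continuousWithinAt) fun s hs => ?_
    rw [interior_Ici] at hs
    rw [(h2 s (hr.trans hs)).deriv]
    exact hw₂ s (hr.trans hs)
  by_contra hneg
  push Not at hneg
  have hr1 : r + 1 ∈ Set.Ici r := Set.mem_Ici.2 (by linarith)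
  have hneg' : w₁ (r + 1) < 0 := (hanti Set.self_mem_Ici hr1 (by linarith)).trans_le hneg
  have key := antitoneOn_Ici_of_hasDerivAt_nonpos (a := r + 1)
    (fun s hs => (h1 s (by linarith)).fun_sub ((hasDerivAt_id' s).const_mul (w₁ (r + 1))))
    (fun s hs => by
      have := hanti.antitoneOn hr1 (show r ≤ s by linarith) hs
      linarith)
  -- By concavity `w` lies below its tangent line at `r + 1`, which reaches zero after time `T`.
  set T := w (r + 1) / -w₁ (r + 1)
  have hT : 0 < T := div_pos (hw _ (by linarith)) (by linarith)
  have h := key Set.self_mem_Ici (show r + 1 ≤ r + 1 + T by linarith) (by linarith)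
  have hTe : w₁ (r + 1) * T = -w (r + 1) := by
    simp only [T]
    rw [div_neg, mul_neg, mul_div_cancel₀ _ hneg'.ne]
  have := hw (r + 1 + T) (by linarith)
  simp only at h
  linarith

/-- A rotationally symmetric steady soliton of positive curvature has a radial potential, and
solves the soliton ODE system. -/
lemma RMetric.IsRotationallySymmetric.exists_solitonODE {n : ℕ} {g : RMetric n} {w : ℝ → ℝ}
    (hs : g.IsRotationallySymmetric w) {f : RSpace n → ℝ} {ρ : ℝ}
    (hsol : g.IsGradientEinsteinSoliton f ρ 0) (hn : 3 ≤ n)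
    (hpos : g.HasPositiveSectionalCurvature) :
    ∃ φ φ₁ φ₂ : ℝ → ℝ, (∀ x, f x = φ ‖x‖) ∧ SolitonODE (((n : ℝ) - 1) * ρ) ((n : ℝ) - 2)
      w (deriv w) (deriv (deriv w)) φ φ₁ φ₂ := by
  have hn' : (3 : ℝ) ≤ n := by exact_mod_cast hn
  have hw := hs.2.1
  have hw₂ : ∀ r, 0 < r → deriv (deriv w) r < 0 := by
    intro r hr
    have h := hs.radialCurv_pos hn hpos hr
    rw [radialCurv, lt_div_iff₀ (hw r hr)] at h
    linarith
  have hX : ∀ r, 0 < r → deriv w r ^ 2 < 1 := by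
    intro r hr
    have h := hs.sphericalCurv_pos hn hpos hr
    rw [sphericalCurv, lt_div_iff₀ (pow_pos (hw r hr) 2)] at h
    linarith
  have hw₁ : ∀ r, 0 < r → 0 < deriv w r := fun r hr =>
    pos_of_hasDerivAt_of_neg_deriv (fun r => hs.hasDerivAt) (fun r => hs.hasDerivAt_deriv) hw hw₂ hr
  have hanti : StrictAntiOn (deriv w) (Set.Ioi 0) := by
    refine strictAntiOn_of_deriv_neg (convex_Ioi 0)
      (fun s hs' => (hs.hasDerivAt_deriv hs').continuousAt.continuousWithinAt) fun s hs' => ?_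
    rw [interior_Ioi] at hs'
    exact hw₂ s hs'
  -- `w'` is positive and strictly decreasing; this excludes nonradial potentials.
  have hmono : deriv w 1 ^ 2 ≠ deriv w 2 ^ 2 := by
    have h := hanti (Set.mem_Ioi.2 one_pos) (Set.mem_Ioi.2 two_pos) one_lt_two
    exact (pow_lt_pow_left₀ h (hw₁ 2 two_pos).le two_ne_zero).ne'
  obtain ⟨φ, φ₁, hφ, h1, h2, h3⟩ := hs.exists_radial_potential hsol hn hmono
  refine ⟨φ, φ₁, fun r => ρ * scalarCurv n w r - ((n : ℝ) - 1) * radialCurv w r, hφ, ?_⟩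
  refine { hasDerivAt_w := fun r => hs.hasDerivAt
           hasDerivAt_w₁ := fun r => hs.hasDerivAt_deriv
           hasDerivAt_φ := h1
           hasDerivAt_φ₁ := h2
           w_pos := hw
           w₁_pos := hw₁
           w₁_lt_one := fun r hr => ?_
           w₂_neg := hw₂
           one_le_c := by linarith
           radial_eq := fun r hr => ?_
           spherical_eq := fun r hr => ?_ }
  · have := hX r hr
    nlinarith
  · have := hw r hr
    simp only [scalarCurv, radialCurv, sphericalCurv]
    field_simp
    ring
  · rw [h3 r hr]
    have := hw r hr
    simp only [scalarCurv, radialCurv, sphericalCurv]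
    field_simp
    ring

theorem mainTheorem11 (n : ℕ) (hn : 3 ≤ n) (ρ : ℝ)
    (hρ : ρ < 1 / (2 * ((n : ℝ) - 1)) ∨ 1 / ((n : ℝ) - 1) ≤ ρ)
    (g : RMetric n) (w : ℝ → ℝ) (f : RSpace n → ℝ)
    (hsym : g.IsRotationallySymmetric w)
    (hsol : g.IsGradientEinsteinSoliton f ρ 0)
    (hpos : g.HasPositiveSectionalCurvature)
    (hnorm : g.scalar 0 = 1) :
    TwoSidedO w
      (fun r => r ^ ((1 - ((n : ℝ) - 1) * ρ) / (2 - 3 * ((n : ℝ) - 1) * ρ))) ∧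
    (∃ φ : ℝ → ℝ, (∀ x, f x = φ ‖x‖) ∧
      TwoSidedO (fun r => |φ r|)
        (fun r => r ^ ((2 - 4 * ((n : ℝ) - 1) * ρ) / (2 - 3 * ((n : ℝ) - 1) * ρ)))) ∧
    TwoSidedO (fun r => (g.vol (g.rball 0 r)).toReal)
      (fun r => r ^ (((n : ℝ) - 1) *
        ((1 - ((n : ℝ) - 1) * ρ) / (2 - 3 * ((n : ℝ) - 1) * ρ)) + 1)) ∧
    (ρ = 1 / ((n : ℝ) - 1) →
      IsAsymptoticallyCylindrical w ∧
        TwoSidedO (fun r => (g.vol (g.rball 0 r)).toReal) (fun r => r)) := by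
  have hn' : (3 : ℝ) ≤ n := by exact_mod_cast hn
  have hN : 0 < (n : ℝ) - 1 := by linarith
  obtain ⟨φ, φ₁, φ₂, hφ, H⟩ := hsym.exists_solitonODE hsol hn hpos
  have hassoc : 3 * ((n : ℝ) - 1) * ρ = 3 * (((n : ℝ) - 1) * ρ) := by ring
  have hassoc' : 4 * ((n : ℝ) - 1) * ρ = 4 * (((n : ℝ) - 1) * ρ) := by ring
  have hm : ((n : ℝ) - 1) * ρ < 1 / 2 ∨ 1 ≤ ((n : ℝ) - 1) * ρ := by
    refine hρ.imp (fun h => ?_) fun h => ?_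
    · rw [lt_div_iff₀ (by positivity)] at h
      linarith
    · rw [div_le_iff₀ hN] at h
      linarith
  have hmρ : ρ = 1 / ((n : ℝ) - 1) → ((n : ℝ) - 1) * ρ = 1 := fun h => by
    rw [h, mul_one_div_cancel hN.ne']
  rw [hassoc, hassoc']
  generalize ((n : ℝ) - 1) * ρ = m at H hm hmρ
  -- Makes the volume exponent positive, so that integration preserves the two-sided bound.
  have hα : 0 ≤ (1 - m) / (2 - 3 * m) := by
    rcases hm with h | h
    · exact div_nonneg (by linarith) (by linarith)
    · exact div_nonneg_of_nonpos (by linarith) (by linarith)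
  obtain ⟨hw, hf⟩ : TwoSidedO w (fun r => r ^ ((1 - m) / (2 - 3 * m))) ∧
      TwoSidedO (fun r => |φ r|) (fun r => r ^ ((2 - 4 * m) / (2 - 3 * m))) := by
    rcases eq_or_ne m 1 with rfl | h1
    · have h := H.asymptotics_of_eq_one
      norm_num at h ⊢
      exact h
    · exact H.asymptotics_of_ne_one (hm.imp_right fun h => lt_of_le_of_ne h h1.symm)
  have hvol := hsym.twoSidedO_vol (by omega) (by positivity) hw
  refine ⟨hw, ⟨φ, hφ, hf⟩, hvol, fun h => ?_⟩
  obtain rfl := hmρ h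
  refine ⟨H.isAsymptoticallyCylindrical, ?_⟩
  norm_num at hvol
  exact hvol
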